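/- Let $s\in(0,1)$, let $N\ge 1$ be an integer with $N>2s$, and let $\Omega\subset\mathbb{R}^N$ be a bounded domain with $C^2$ boundary. Let $\gamma\in(0,1)$, $0<b<\min\{N,4s\}$, $\alpha,\lambda,\beta>0$, and put $2_s^*=\frac{2N}{N-2s}$, $2_b^*=\frac{2N-b}{N-2s}$. For $0<\sigma<1$ and $1\le p<\infty$ let $$[u]_{\sigma,p}^p=\int_{\mathbb{R}^{2N}}\frac{|u(x)-u(y)|^p}{|x-y|^{N+\sigma p}}\,dx\,dy,$$ and let $W_0^{\sigma,p}(\Omega)$ be the space of all $u\in L^p(\mathbb{R}^N)$ with $[u]_{\sigma,p}<\infty$ and $u=0$ a.e. in $\mathbb{R}^N\setminus\Omega$, with norm $\|u\|_{W_0^{\sigma,p}(\Omega)}=[u]_{\sigma,p}$; write $H_0^s(\Omega)=W_0^{s,2}(\Omega)$. Let $(\mu_n)_{n\ge1}\subset L^\infty(\Omega)$ be a sequence that is bounded in $L^1(\Omega)$. Fix a constant $\kappa>0$ (the normalization constant of the quadratic form of $(-\Delta)^s$; for instance $\kappa=1$). For $n\ge1$, a function $u_n\in H_0^s(\Omega)$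 is called a weak solution of $$(-\Delta)^su_n-\alpha\frac{u_n}{|x|^{2s}}=\lambda u_n+\frac{1}{(u_n+\frac1n)^\gamma}+\beta\left(\int_\Omega\frac{u_n^{2_b^*}(y)}{|x-y|^b}\,dy\right)u_n^{2_b^*-1}+\mu_n\ \text{ in }\Omega,\qquad u_n>0\ \text{ in }\Omega,\qquad u_n=0\ \text{ in }\mathbb{R}^N\setminus\Omega,\tag{$P_{\beta,n}$}$$ if for every $\phi\in C_c^\infty(\Omega)$ $$\kappa\int_{\mathbb{R}^{2N}}\frac{(u_n(x)-u_n(y))(\phi(x)-\phi(y))}{|x-y|^{N+2s}}\,dx\,dy-\alpha\int_\Omega\frac{u_n\phi}{|x|^{2s}}\,dx=\lambda\int_\Omega u_n\phi\,dx+\int_\Omega\frac{\phi}{(u_n+\frac1n)^\gamma}\,dx+\beta\int_\Omega\int_\Omega\frac{u_n^{2_b^*}(y)\,u_n^{2_b^*-1}(x)\,\phi(x)}{|x-y|^b}\,dx\,dy+\int_\Omega\mu_n\phi\,dx,$$ and if for every compact $K\subset\Omega$ there is a constant $c_K>0$ (which may depend on $n$) with $u_n\ge c_K$ a.e. in $K$.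 For every $n\ge 1$ let $u_n$ be a weak solution of $(P_{\beta,n})$ with $\|u_n\|_{L^{2_s^*}(\Omega)}=1$. Then, for every $\bar s\in(0,s)$ and every $m\in\left[1,\frac{N}{N-s}\right)$, the sequence $(u_n)_{n\ge1}$ is contained and bounded in $W_0^{\bar s,m}(\Omega)$: there is a constant $C$ such that $u_n\in W_0^{\bar s,m}(\Omega)$ and $\|u_n\|_{W_0^{\bar s,m}(\Omega)}\le C$ for all $n\ge1$. -/

import Mathlib

open MeasureTheory Set
open scoped ENNReal ContDiff Topology

noncomputable section

namespace FracChoquard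

/-- Euclidean space `ℝ^N`. -/
abbrev RN (N : ℕ) : Type := EuclideanSpace ℝ (Fin N)

/-- The critical Sobolev exponent `2_s^* = 2N / (N - 2s)`. -/
def twoStar (N : ℕ) (s : ℝ) : ℝ := 2 * N / (N - 2 * s)

/-- The critical Hardy-Littlewood-Sobolev exponent `2_b^* = (2N - b) / (N - 2s)`. -/
def twoStarB (N : ℕ) (s b : ℝ) : ℝ := (2 * N - b) / (N - 2 * s)

/-- The Gagliardo energy `∫_{ℝ^{2N}} |u(x) - u(y)|^p / |x - y|^{N + σ p} dx dy`,
as an extended nonnegative real. -/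
def gagliardo {N : ℕ} (σ p : ℝ) (u : RN N → ℝ) : ℝ≥0∞ :=
  ∫⁻ z : RN N × RN N,
    ENNReal.ofReal (|u z.1 - u z.2| ^ p / ‖z.1 - z.2‖ ^ ((N : ℝ) + σ * p))

/-- `u ∈ W_0^{σ,p}(Ω)`: `u ∈ L^p(ℝ^N)`, the Gagliardo energy of `u` is finite and `u = 0`
(almost everywhere) outside `Ω`. -/
structure MemW0 {N : ℕ} (Ω : Set (RN N)) (σ p : ℝ) (u : RN N → ℝ) : Prop where
  memLp : MemLp u (ENNReal.ofReal p) volume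
  gagliardo_lt_top : gagliardo σ p u < ⊤
  zero_outside : ∀ᵐ x : RN N, x ∉ Ω → u x = 0

/-- The norm of `W_0^{σ,p}(Ω)`. -/
def normW0 {N : ℕ} (σ p : ℝ) (u : RN N → ℝ) : ℝ≥0∞ :=
  gagliardo σ p u ^ (1 / p)

/-- `∂Ω` is of class `C^2`: near each boundary point, `Ω` is the sublevel set `{ρ < 0}` of a
`C^2` function `ρ` whose differential does not vanish at that point. -/
def HasC2Boundary {N : ℕ} (Ω : Set (RN N)) : Prop :=
  ∀ p ∈ frontier Ω, ∃ U : Set (RN N), IsOpen U ∧ p ∈ U ∧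
    ∃ ρ : RN N → ℝ, ContDiffOn ℝ 2 ρ U ∧ fderiv ℝ ρ p ≠ 0 ∧
      Ω ∩ U = {x | x ∈ U ∧ ρ x < 0}

/-- `φ ∈ C_c^∞(Ω)`. -/
structure IsTestFunction {N : ℕ} (Ω : Set (RN N)) (φ : RN N → ℝ) : Prop where
  contDiff : ContDiff ℝ ∞ φ
  hasCompactSupport : HasCompactSupport φ
  tsupport_subset : tsupport φ ⊆ Ω

/-- The bilinear form of the fractional Laplacian,
`∫_{ℝ^{2N}} (u(x) - u(y)) (φ(x) - φ(y)) / |x - y|^{N + 2s} dx dy`. -/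
def fracForm {N : ℕ} (s : ℝ) (u φ : RN N → ℝ) : ℝ :=
  ∫ z : RN N × RN N,
    (u z.1 - u z.2) * (φ z.1 - φ z.2) / ‖z.1 - z.2‖ ^ ((N : ℝ) + 2 * s)

/-- `u` is a weak solution, for the index `n ≥ 1` and the datum `μn`, of
`(-Δ)^s u - α u / |x|^{2s} = λ u + (u + 1/n)^{-γ}
    + β (∫_Ω u(y)^{2_b^*} / |x - y|^b dy) u^{2_b^* - 1} + μn` in `Ω`,
`u > 0` in `Ω`, `u = 0` outside `Ω`.
The number `κ` is the normalization constant in the quadratic form of `(-Δ)^s`. -/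
structure IsWeakSolution {N : ℕ} (Ω : Set (RN N)) (κ s b γ α lam β : ℝ) (n : ℕ)
    (μn : RN N → ℝ) (u : RN N → ℝ) : Prop where
  memH : MemW0 Ω s 2 u
  weak_form : ∀ φ : RN N → ℝ, IsTestFunction Ω φ →
    κ * fracForm s u φ - α * (∫ x in Ω, u x * φ x / ‖x‖ ^ (2 * s)) =
      lam * (∫ x in Ω, u x * φ x)
      + (∫ x in Ω, φ x / (u x + 1 / (n : ℝ)) ^ γ)
      + β * (∫ z in Ω ×ˢ Ω,
          u z.2 ^ twoStarB N s b * u z.1 ^ (twoStarB N s b - 1) * φ z.1 / ‖z.1 - z.2‖ ^ b)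
      + (∫ x in Ω, μn x * φ x)
  locally_pos : ∀ K : Set (RN N), IsCompact K → K ⊆ Ω →
    ∃ c : ℝ, 0 < c ∧ ∀ᵐ x ∂(volume.restrict K), c ≤ u x

end FracChoquard

end

open MeasureTheory Set
open scoped ENNReal ContDiff Topology

namespace FracChoquard

open Filter Metric
open scoped Convolution

/-! The equation is tested with the bounded function `saturate (u n)`, which is u/(1+u) because u ≥
0. The difference of this function at x and y is (u(x)-u(y))/((1+u(x))(1+u(y))), so the quadratic
form becomes the integral of `energyDensity`. Every term on the other side is bounded uniformly in
n. The Hardy, linear and Choquard terms are bounded in L¹ by the normalization in L^{2_s^*}, so the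
Hardy term need not be absorbed and α need not be small. The singular term is at most |Ω| because
u/(1+u) ≤ u^γ, and the datum is bounded in L¹. This is `exists_lintegral_energyDensity_le`.

Young's inequality with exponents 2/m and 2/(2-m) then bounds the (σ,m) difference quotient by the
energy density plus ((1+u(x))(1+u(y)))^{m/(2-m)} times a kernel that is integrable near the diagonal
since σ < s. The weight is controlled by the L^{2_s^*} norm exactly when 2m/(2-m) ≤ 2_s^*, that is,
when m ≤ N/(N-s). This is `exists_gagliardo_le`.

The delicate point is that `saturate (u n)` is not a test function (`WeakIdentity.saturate`). It is
cut off near the boundary and mollified. Mollification does not increase the Gagliardo energy, and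
the cutoffs keep it bounded by a Hardy-type argument: exterior balls show that d(y)^{-2s} is
controlled by the kernel mass outside Ω, where the function vanishes. Bounded energy and convergence
almost everywhere give weak L² convergence of the difference quotients, hence convergence of the
quadratic form; dominated convergence handles the other terms. -/

/-! ### Weak limits in L² -/

/-- Clipping changes f only where |f| > R|g|; there |g| < |f|/R, so the error |g||f| is at most
f²/R. The clipped product is dominated by R g², which is independent of f. -/
lemma abs_mul_sub_mul_clip_le {R g f : ℝ} (hR : 0 < R) :
    |g * f - g * max (-(R * |g|)) (min f (R * |g|))| ≤ f ^ 2 / R := by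
  have hg := abs_nonneg g
  have hRg : 0 ≤ R * |g| := by positivity
  rw [← mul_sub, abs_mul, le_div_iff₀ hR]
  by_cases h : |f| ≤ R * |g|
  · rw [min_eq_left (abs_le.1 h).2, max_eq_right (abs_le.1 h).1]
    simp [sq_nonneg]
  · push Not at h
    have h1 : |f - max (-(R * |g|)) (min f (R * |g|))| ≤ |f| := by
      rcases le_total 0 f with hf | hf
      · rw [abs_of_nonneg hf] at h ⊢
        rw [min_eq_right h.le, max_eq_right (by linarith), abs_of_nonneg] <;> linarith
      · rw [abs_of_nonpos hf] at h ⊢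
        rw [min_eq_left (by linarith), max_eq_left (by linarith), abs_of_nonpos] <;> linarith
    calc _ ≤ |g| * |f| * R := by gcongr
      _ = (R * |g|) * |f| := by ring
      _ ≤ |f| * |f| := by gcongr
      _ = f ^ 2 := by rw [← sq, sq_abs]

/-- A sequence bounded in `L²` and converging almost everywhere converges weakly in `L²`. -/
lemma tendsto_integral_mul_of_ae_tendsto_of_sq_bounded {X : Type*} [MeasurableSpace X]
    {ν : Measure X} {g : X → ℝ} {f : ℕ → X → ℝ} {f₀ : X → ℝ} {C : ℝ≥0∞} (hC : C ≠ ⊤)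
    (hg : MemLp g 2 ν) (hf : ∀ k, AEStronglyMeasurable (f k) ν)
    (hb : ∀ k, ∫⁻ x, ENNReal.ofReal (f k x ^ 2) ∂ν ≤ C)
    (hlim : ∀ᵐ x ∂ν, Tendsto (fun k => f k x) atTop (𝓝 (f₀ x))) :
    Tendsto (fun k => ∫ x, g x * f k x ∂ν) atTop (𝓝 (∫ x, g x * f₀ x ∂ν)) := by
  have hf₀ : AEStronglyMeasurable f₀ ν := aestronglyMeasurable_of_tendsto_ae _ hf hlim
  have hb₀ : ∫⁻ x, ENNReal.ofReal (f₀ x ^ 2) ∂ν ≤ C := by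
    calc _ = ∫⁻ x, liminf (fun k => ENNReal.ofReal (f k x ^ 2)) atTop ∂ν := by
          refine lintegral_congr_ae ?_
          filter_upwards [hlim] with x hx
          exact ((ENNReal.continuous_ofReal.tendsto _).comp (hx.pow 2)).liminf_eq.symm
      _ ≤ liminf (fun k => ∫⁻ x, ENNReal.ofReal (f k x ^ 2) ∂ν) atTop :=
          lintegral_liminf_le' fun k => ((hf k).aemeasurable.pow_const 2).ennreal_ofReal
      _ ≤ C := by
          refine (liminf_le_liminf (Eventually.of_forall hb)).trans ?_
          simp
  have mem : ∀ {w : X → ℝ}, AEStronglyMeasurable w ν →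
      ∫⁻ x, ENNReal.ofReal (w x ^ 2) ∂ν ≤ C → Integrable (fun x => w x ^ 2) ν := by
    intro w hw hwb
    refine ⟨hw.pow 2, ?_⟩
    rw [hasFiniteIntegral_iff_ofReal (Eventually.of_forall fun x => sq_nonneg _)]
    exact hwb.trans_lt hC.lt_top
  have clipm : ∀ {w : X → ℝ} (R : ℝ), AEStronglyMeasurable w ν → AEStronglyMeasurable
      (fun x => g x * max (-(R * |g x|)) (min (w x) (R * |g x|))) ν := by
    intro w R hw
    have h1 : AEStronglyMeasurable (fun x => R * |g x|) ν := (hg.1.norm.const_mul R)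
    exact hg.1.mul (h1.neg.sup (hw.inf h1))
  have clipb : ∀ {R : ℝ} (_ : 0 < R) (w : ℝ) (x : X),
      |g x * max (-(R * |g x|)) (min w (R * |g x|))| ≤ R * g x ^ 2 := by
    intro R hR w x
    have h0 : 0 ≤ R * |g x| := by positivity
    have : |max (-(R * |g x|)) (min w (R * |g x|))| ≤ R * |g x| := by
      rw [abs_le]
      exact ⟨le_max_left _ _, max_le (by linarith) (min_le_right _ _)⟩
    rw [abs_mul]
    calc _ ≤ |g x| * (R * |g x|) := by gcongr
      _ = R * |g x| ^ 2 := by ring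
      _ = _ := by rw [sq_abs]
  have hg2 := hg.integrable_sq
  have clipi : ∀ {w : X → ℝ} {R : ℝ}, 0 < R → AEStronglyMeasurable w ν → Integrable
      (fun x => g x * max (-(R * |g x|)) (min (w x) (R * |g x|))) ν := by
    intro w R hR hw
    exact (hg2.const_mul R).mono' (clipm R hw) (Eventually.of_forall fun x => clipb hR _ x)
  have hmul : ∀ {w : X → ℝ}, AEStronglyMeasurable w ν → Integrable (fun x => w x ^ 2) ν →
      Integrable (fun x => g x * w x) ν := by
    intro w hw hwi
    refine (hg2.add hwi).mono' (hg.1.mul hw) (Eventually.of_forall fun x => ?_)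
    simp only [Real.norm_eq_abs, abs_mul, Pi.add_apply]
    nlinarith [sq_abs (g x), sq_abs (w x), sq_nonneg (|g x| - |w x|), abs_nonneg (g x),
      abs_nonneg (w x)]
  have herr : ∀ {w : X → ℝ} {R : ℝ}, 0 < R → AEStronglyMeasurable w ν →
      ∫⁻ x, ENNReal.ofReal (w x ^ 2) ∂ν ≤ C →
      |∫ x, g x * w x ∂ν - ∫ x, g x * max (-(R * |g x|)) (min (w x) (R * |g x|)) ∂ν|
        ≤ C.toReal / R := by
    intro w R hR hw hwb
    rw [← integral_sub (hmul hw (mem hw hwb)) (clipi hR hw), ← Real.norm_eq_abs]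
    calc _ ≤ ∫ x, w x ^ 2 / R ∂ν := by
          refine norm_integral_le_of_norm_le ((mem hw hwb).div_const R)
            (Eventually.of_forall fun x => abs_mul_sub_mul_clip_le hR)
      _ = (∫ x, w x ^ 2 ∂ν) / R := integral_div _ _
      _ ≤ C.toReal / R := by
          gcongr
          rw [integral_eq_lintegral_of_nonneg_ae (Eventually.of_forall fun x => sq_nonneg _)
            (hw.pow 2)]
          exact ENNReal.toReal_mono hC hwb
  rw [Metric.tendsto_atTop]
  intro ε hε
  obtain ⟨R, hR, hRε⟩ : ∃ R : ℝ, 0 < R ∧ C.toReal / R < ε / 3 := by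
    -- The added 1 keeps R positive when C = 0 and makes the inequality strict.
    refine ⟨(C.toReal + 1) / (ε / 3), by positivity, ?_⟩
    rw [div_lt_iff₀ (by positivity), mul_div_cancel₀ _ (by positivity)]
    linarith
  have hclip : Tendsto (fun k => ∫ x, g x * max (-(R * |g x|)) (min (f k x) (R * |g x|)) ∂ν) atTop
      (𝓝 (∫ x, g x * max (-(R * |g x|)) (min (f₀ x) (R * |g x|)) ∂ν)) := by
    refine tendsto_integral_of_dominated_convergence (fun x => R * g x ^ 2)
      (fun k => clipm R (hf k)) (hg2.const_mul R)
      (fun k => Eventually.of_forall fun x => clipb hR _ x) ?_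
    filter_upwards [hlim] with x hx
    exact ((tendsto_const_nhds.max (hx.min tendsto_const_nhds)).const_mul _)
  obtain ⟨k₀, hk₀⟩ := (Metric.tendsto_atTop.1 hclip) (ε / 3) (by positivity)
  refine ⟨k₀, fun k hk => ?_⟩
  have h1 := hk₀ k hk
  have h2 := herr hR (hf k) (hb k)
  have h3 := herr hR hf₀ hb₀
  rw [Real.dist_eq] at h1 ⊢
  rw [abs_lt] at h1 ⊢
  rw [abs_le] at h2 h3
  constructor <;> linarith [h2.1, h2.2, h3.1, h3.2, h1.1, h1.2]

/-! ### Integrability of powers of the norm -/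

lemma finrank_RN (N : ℕ) : Module.finrank ℝ (RN N) = N := by simp [RN]

lemma nontrivial_RN {N : ℕ} (hN : 1 ≤ N) : Nontrivial (RN N) := by
  apply Module.nontrivial_of_finrank_pos (R := ℝ)
  rw [finrank_RN]; omega

lemma lintegral_ball_norm_rpow_lt_top {N : ℕ} (hN : 1 ≤ N) {t : ℝ} (ht : t < N) (R : ℝ) :
    ∫⁻ x in ball (0 : RN N) R, ENNReal.ofReal (‖x‖ ^ (-t)) < ⊤ := by
  have := nontrivial_RN hN
  have h : IntegrableOn (fun x : RN N => ‖x‖ ^ (-t)) (ball 0 R) volume := by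
    rw [integrableOn_fun_norm_addHaar volume (f := fun r : ℝ => r ^ (-t)), finrank_RN]
    rcases le_or_gt R 0 with hR | hR
    · simp [Ioo_eq_empty_of_le hR]
    rw [integrableOn_congr_fun (g := fun y : ℝ => y ^ ((N : ℝ) - 1 - t)) _ measurableSet_Ioo]
    · rw [intervalIntegral.integrableOn_Ioo_rpow_iff hR]
      linarith
    · intro y hy
      have hy0 : 0 < y := hy.1
      simp only [smul_eq_mul]
      rw [← Real.rpow_natCast, ← Real.rpow_add hy0]
      congr 1
      push_cast [Nat.cast_sub hN]
      ring
  exact h.setLIntegral_lt_top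

lemma lintegral_compl_ball_norm_rpow_lt_top {N : ℕ} (hN : 1 ≤ N) {t : ℝ} (ht : (N : ℝ) < t) :
    ∫⁻ x in (ball (0 : RN N) 1)ᶜ, ENNReal.ofReal (‖x‖ ^ (-t)) < ⊤ := by
  have := nontrivial_RN hN
  have h : Integrable (fun x : RN N => (Ici (1:ℝ)).indicator (fun r : ℝ => r ^ (-t)) ‖x‖)
      volume := by
    rw [integrable_fun_norm_addHaar volume (f := (Ici (1:ℝ)).indicator (fun r : ℝ => r ^ (-t))),
      finrank_RN]
    have h1 : IntegrableOn (fun y : ℝ => y ^ ((N : ℝ) - 1 - t)) (Ici 1) := by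
      rw [integrableOn_Ici_iff_integrableOn_Ioi]
      exact integrableOn_Ioi_rpow_of_lt (by linarith) one_pos
    have h2 := (integrable_indicator_iff measurableSet_Ici).2 h1
    refine (h2.integrableOn (s := Ioi 0)).congr_fun ?_ measurableSet_Ioi
    intro y hy
    have hy0 : 0 < y := hy
    by_cases hy1 : y ∈ Ici (1 : ℝ)
    · simp only [indicator_of_mem hy1, smul_eq_mul]
      rw [← Real.rpow_natCast, ← Real.rpow_add hy0]
      congr 1
      push_cast [Nat.cast_sub hN]
      ring
    · simp [indicator_of_notMem hy1]
  have h3 := h.lintegral_lt_top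
  refine lt_of_le_of_lt ?_ h3
  rw [← lintegral_indicator measurableSet_ball.compl]
  refine lintegral_mono fun x => ?_
  by_cases hx : x ∈ (ball (0 : RN N) 1)ᶜ
  · have : ‖x‖ ∈ Ici (1:ℝ) := by simpa using hx
    rw [indicator_of_mem hx, indicator_of_mem this]
  · rw [indicator_of_notMem hx]; exact zero_le

/-! ### Exterior balls and the kernel mass outside Ω -/

/-- Near a boundary point the complement of `Ω` contains a uniform truncated cone with vertex at
each nearby boundary point. -/
lemma exists_exterior_ball_nhds {N : ℕ} {Ω : Set (RN N)} (hΩo : IsOpen Ω)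
    (hΩr : HasC2Boundary Ω) {p : RN N} (hp : p ∈ frontier Ω) :
    ∃ r > 0, ∃ ε > 0, ∃ t₀ > 0, ∀ q ∈ frontier Ω ∩ ball p r, ∀ t, 0 < t → t ≤ t₀ →
      ∃ z, dist z q ≤ t ∧ ball z (ε * t) ⊆ Ωᶜ := by
  obtain ⟨U, hU, hpU, ρ, hρ, hL, hΩU⟩ := hΩr p hp
  have hmem : ∀ x ∈ U, x ∈ Ω ↔ ρ x < 0 := fun x hx =>
    ⟨fun h => (hΩU.subset ⟨h, hx⟩).2, fun h => (hΩU.superset ⟨hx, h⟩).1⟩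
  have hd : HasStrictFDerivAt ρ (fderiv ℝ ρ p) p :=
    (hρ.contDiffAt (hU.mem_nhds hpU)).hasStrictFDerivAt (by norm_num)
  set L := fderiv ℝ ρ p
  obtain ⟨ν, hν1, hνL⟩ : ∃ ν : RN N, ‖ν‖ = 1 ∧ 0 < L ν := by
    obtain ⟨w, hw⟩ : ∃ w, L w ≠ 0 := by
      by_contra! h
      exact hL (ContinuousLinearMap.ext h)
    obtain ⟨w, hw⟩ : ∃ w, 0 < L w := by
      rcases lt_or_gt_of_ne hw with h | h
      · exact ⟨-w, by simpa using h⟩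
      · exact ⟨w, h⟩
    have hw0 : 0 < ‖w‖ := norm_pos_iff.2 (by rintro rfl; simp at hw)
    refine ⟨‖w‖⁻¹ • w, ?_, ?_⟩
    · rw [norm_smul, norm_inv, norm_norm, inv_mul_cancel₀ hw0.ne']
    · rw [map_smul, smul_eq_mul]; positivity
  set c := L ν with hc
  -- Strict differentiability controls the remainder for pairs of points near p, so one radius δ
  -- serves every nearby boundary point q.
  have hbound := hd.isLittleO.bound (show (0:ℝ) < c / 8 by positivity)
  have hUU : ∀ᶠ x in 𝓝 (p, p), x.1 ∈ U := by
    exact (continuous_fst.tendsto (p, p)).eventually (hU.mem_nhds hpU)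
  obtain ⟨δ, hδ, hball⟩ := Metric.eventually_nhds_iff_ball.1 (hbound.and hUU)
  have hLn : 0 < ‖L‖ := norm_pos_iff.2 hL
  set ε := min 1 (c / (4 * ‖L‖)) with hε
  -- With ε ≤ 1 one has |y-q| ≤ 2t, so the remainder is at most ct/4. With ε ≤ c/(4‖L‖) the
  -- deviation from t • ν costs at most another ct/4. Since L(t • ν) = ct, ρ stays positive on the
  -- ball.
  have hε0 : 0 < ε := by positivity
  refine ⟨δ / 2, by positivity, ε, hε0, δ / 8, by positivity, ?_⟩
  rintro q ⟨hq, hqp⟩ t ht htδ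
  refine ⟨q + t • ν, ?_, ?_⟩
  · rw [dist_eq_norm, add_sub_cancel_left, norm_smul, hν1, mul_one, Real.norm_of_nonneg ht.le]
  intro y hy
  rw [mem_ball] at hy hqp
  have hyq : ‖y - q - t • ν‖ < ε * t := by
    rwa [dist_eq_norm, ← sub_sub] at hy
  have hyq' : ‖y - q‖ ≤ 2 * t := by
    calc ‖y - q‖ = ‖(y - q - t • ν) + t • ν‖ := by simp
      _ ≤ ε * t + t := by
        refine (norm_add_le _ _).trans (add_le_add hyq.le ?_)
        rw [norm_smul, hν1, mul_one, Real.norm_of_nonneg ht.le]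
      _ ≤ 1 * t + t := by gcongr; exact min_le_left _ _
      _ = 2 * t := by ring
  have hyp : dist y p < δ := by
    calc dist y p ≤ dist y q + dist q p := dist_triangle _ _ _
      _ < 2 * t + δ / 2 := by rw [dist_eq_norm y q]; linarith
      _ < δ := by linarith
  have hqp' : dist q p < δ := by linarith
  have h1 := (hball (y, q) (by
    rw [mem_ball, Prod.dist_eq]; exact max_lt hyp hqp')).1
  have hyU := (hball (y, q) (by
    rw [mem_ball, Prod.dist_eq]; exact max_lt hyp hqp')).2
  have hqU := (hball (q, q) (by
    rw [mem_ball, Prod.dist_eq]; exact max_lt hqp' hqp')).2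
  have hqΩ : q ∉ Ω := by
    rw [hΩo.frontier_eq] at hq; exact hq.2
  have hρq : 0 ≤ ρ q := by
    by_contra! h
    exact hqΩ ((hmem q hqU).2 h)
  intro hyΩ
  have hρy := (hmem y hyU).1 hyΩ
  simp only [Real.norm_eq_abs] at h1
  have h2 : L (y - q) = L (y - q - t • ν) + t * c := by
    rw [map_sub L (y - q), map_smul, smul_eq_mul]; ring
  have h3 : |L (y - q - t • ν)| ≤ c / 4 * t := by
    calc |L (y - q - t • ν)| ≤ ‖L‖ * ‖y - q - t • ν‖ := L.le_opNorm _
      _ ≤ ‖L‖ * (c / (4 * ‖L‖) * t) := by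
        gcongr
        exact hyq.le.trans (by gcongr; exact min_le_right _ _)
      _ = c / 4 * t := by field_simp
  have h4 : c / 8 * ‖y - q‖ ≤ c / 8 * (2 * t) := by gcongr
  have h5 : 0 < c * t := by positivity
  have h6 := (abs_le.1 h1).1
  have h7 := (abs_le.1 h3).1
  linarith

lemma exists_uniform_exterior_ball {N : ℕ} {Ω : Set (RN N)} (hΩo : IsOpen Ω)
    (hΩb : Bornology.IsBounded Ω) (hΩr : HasC2Boundary Ω) :
    ∃ ε > 0, ∃ t₀ > 0, ∀ q ∈ frontier Ω, ∀ t, 0 < t → t ≤ t₀ →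
      ∃ z, dist z q ≤ t ∧ ball z (ε * t) ⊆ Ωᶜ := by
  have hc : IsCompact (frontier Ω) :=
    Metric.isCompact_of_isClosed_isBounded isClosed_frontier
      (hΩb.closure.subset frontier_subset_closure)
  suffices H : ∃ ε > 0, ∃ t₀ > 0, ∀ q ∈ frontier Ω ∩ frontier Ω, ∀ t, 0 < t → t ≤ t₀ →
      ∃ z, dist z q ≤ t ∧ ball z (ε * t) ⊆ Ωᶜ by simpa using H
  refine hc.induction_on (p := fun S => ∃ ε > 0, ∃ t₀ > 0, ∀ q ∈ frontier Ω ∩ S, ∀ t, 0 < t →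
      t ≤ t₀ → ∃ z, dist z q ≤ t ∧ ball z (ε * t) ⊆ Ωᶜ) ?_ ?_ ?_ ?_
  · exact ⟨1, one_pos, 1, one_pos, by simp⟩
  · rintro S T hST ⟨ε, hε, t₀, ht₀, h⟩
    exact ⟨ε, hε, t₀, ht₀, fun q hq => h q ⟨hq.1, hST hq.2⟩⟩
  · rintro S T ⟨ε, hε, t₀, ht₀, h⟩ ⟨ε', hε', t₀', ht₀', h'⟩
    refine ⟨min ε ε', by positivity, min t₀ t₀', by positivity, ?_⟩
    rintro q ⟨hq, hq' | hq'⟩ t ht htt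
    · obtain ⟨z, hz, hz'⟩ := h q ⟨hq, hq'⟩ t ht (htt.trans (min_le_left _ _))
      exact ⟨z, hz, (ball_subset_ball (by gcongr; exact min_le_left _ _)).trans hz'⟩
    · obtain ⟨z, hz, hz'⟩ := h' q ⟨hq, hq'⟩ t ht (htt.trans (min_le_right _ _))
      exact ⟨z, hz, (ball_subset_ball (by gcongr; exact min_le_right _ _)).trans hz'⟩
  · intro p hp
    obtain ⟨r, hr, ε, hε, t₀, ht₀, h⟩ := exists_exterior_ball_nhds hΩo hΩr hp
    exact ⟨ball p r, mem_nhdsWithin_of_mem_nhds (ball_mem_nhds p hr), ε, hε, t₀, ht₀, h⟩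

lemma compl_nonempty_of_isBounded {N : ℕ} (hN : 1 ≤ N) {Ω : Set (RN N)}
    (hΩb : Bornology.IsBounded Ω) : Ωᶜ.Nonempty := by
  have := nontrivial_RN hN
  rw [nonempty_compl]
  rintro rfl
  exact NormedSpace.unbounded_univ ℝ (RN N) hΩb

lemma infDist_compl_pos {N : ℕ} (hN : 1 ≤ N) {Ω : Set (RN N)} (hΩo : IsOpen Ω)
    (hΩb : Bornology.IsBounded Ω) {y : RN N} (hy : y ∈ Ω) : 0 < infDist y Ωᶜ := by
  rw [← hΩo.isClosed_compl.notMem_iff_infDist_pos (compl_nonempty_of_isBounded hN hΩb)]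
  simpa using hy

lemma exists_exterior_ball {N : ℕ} (hN : 1 ≤ N) {Ω : Set (RN N)} (hΩo : IsOpen Ω)
    (hΩb : Bornology.IsBounded Ω) (hΩr : HasC2Boundary Ω) :
    ∃ ε > 0, ∀ y ∈ Ω, ∃ z, ball z (ε * infDist y Ωᶜ) ⊆ Ωᶜ ∧
      ball z (ε * infDist y Ωᶜ) ⊆ closedBall y (3 * infDist y Ωᶜ) := by
  obtain ⟨ε, hε, t₀, ht₀, h⟩ := exists_uniform_exterior_ball hΩo hΩb hΩr
  obtain ⟨e, he⟩ := compl_nonempty_of_isBounded hN hΩb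
  obtain ⟨R, hR⟩ := hΩb.subset_closedBall e
  set D := max R 1 with hD
  have hD0 : 0 < D := lt_of_lt_of_le one_pos (le_max_right _ _)
  -- Distances to the complement are at most D, so shrinking the scale by c keeps c * d below t₀ and
  -- removes the restriction to small scales.
  set c := min 1 (t₀ / D) with hc
  have hc0 : 0 < c := by positivity
  refine ⟨min 1 (ε * c), by positivity, fun y hy => ?_⟩
  have hd := infDist_compl_pos hN hΩo hΩb hy
  obtain ⟨q, hq, hqd⟩ := hΩo.isClosed_compl.exists_infDist_eq_dist ⟨e, he⟩ y
  have hdD : infDist y Ωᶜ ≤ D :=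
    (infDist_le_dist_of_mem he).trans ((mem_closedBall.1 (hR hy)).trans (le_max_left _ _))
  set d := infDist y Ωᶜ with hdd
  have hqf : q ∈ frontier Ω := by
    rw [hΩo.frontier_eq]
    refine ⟨?_, hq⟩
    have h1 : ball y d ⊆ Ω := ball_infDist_compl_subset
    -- The nearest point q of the complement lies on the closure of the ball of radius d, which is
    -- contained in Ω, so q is a boundary point.
    have h2 := closure_mono h1
    rw [closure_ball y hd.ne'] at h2
    exact h2 (by rw [mem_closedBall, dist_comm, ← hqd])
  have hcd : c * d ≤ t₀ := by
    calc c * d ≤ t₀ / D * D := by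
          gcongr
          exact min_le_right _ _
      _ = t₀ := by field_simp
  obtain ⟨z, hz, hzb⟩ := h q hqf (c * d) (by positivity) hcd
  refine ⟨z, (ball_subset_ball ?_).trans hzb, ?_⟩
  · calc _ ≤ ε * c * d := by gcongr; exact min_le_right _ _
      _ = _ := by ring
  · intro w hw
    rw [mem_ball] at hw
    rw [mem_closedBall]
    have h1 : dist w z ≤ 1 * d := hw.le.trans (by gcongr; exact min_le_left _ _)
    have h2 : dist z q ≤ 1 * d := hz.trans (by gcongr; exact min_le_left _ _)
    have h3 : dist q y = d := by rw [dist_comm, ← hqd]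
    have := dist_triangle4 w z q y
    linarith

/-- The mass of the kernel `|y - z|^{-N - 2s}` over the complement of `Ω` controls
`d(y)^{-2s}`, where `d` is the distance to the complement. -/
lemma exists_infDist_rpow_le_lintegral_compl {N : ℕ} (hN : 1 ≤ N) {Ω : Set (RN N)}
    (hΩo : IsOpen Ω) (hΩb : Bornology.IsBounded Ω) (hΩr : HasC2Boundary Ω) {s : ℝ} (hs : 0 < s) :
    ∃ C : ℝ≥0∞, C ≠ ⊤ ∧ ∀ y ∈ Ω, ENNReal.ofReal (infDist y Ωᶜ ^ (-(2 * s))) ≤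
      C * ∫⁻ z in Ωᶜ, ENNReal.ofReal (1 / ‖y - z‖ ^ ((N : ℝ) + s * 2)) := by
  have := nontrivial_RN hN
  obtain ⟨ε, hε, h⟩ := exists_exterior_ball hN hΩo hΩb hΩr
  set A : ℝ≥0∞ := ENNReal.ofReal ((3:ℝ) ^ (-((N : ℝ) + s * 2)) * ε ^ (N : ℝ)) *
    volume (ball (0 : RN N) 1) with hA
  have hA0 : A ≠ 0 := by
    refine mul_ne_zero ?_ (measure_ball_pos _ _ one_pos).ne'
    rw [ENNReal.ofReal_ne_zero_iff]; positivity
  have hAt : A ≠ ⊤ := ENNReal.mul_ne_top ENNReal.ofReal_ne_top measure_ball_lt_top.ne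
  refine ⟨A⁻¹, ENNReal.inv_ne_top.2 hA0, fun y hy => ?_⟩
  have hd := infDist_compl_pos hN hΩo hΩb hy
  obtain ⟨z, hz1, hz2⟩ := h y hy
  set d := infDist y Ωᶜ
  rw [← one_mul (ENNReal.ofReal (d ^ (-(2 * s)))), ← ENNReal.inv_mul_cancel hA0 hAt, mul_assoc]
  gcongr
  calc A * ENNReal.ofReal (d ^ (-(2 * s)))
      = ∫⁻ w in ball z (ε * d), ENNReal.ofReal ((3 * d) ^ (-((N : ℝ) + s * 2))) := by
        rw [lintegral_const, Measure.restrict_apply_univ,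
          Measure.addHaar_ball _ _ (by positivity), finrank_RN, hA, mul_right_comm,
          ← mul_assoc, ← ENNReal.ofReal_mul (by positivity), ← ENNReal.ofReal_mul (by positivity)]
        congr 2
        rw [Real.mul_rpow (by norm_num) hd.le, ← Real.rpow_natCast,
          Real.mul_rpow hε.le hd.le, show -(2 * s) = -((N : ℝ) + s * 2) + N by ring,
          Real.rpow_add hd]
        ring
    _ ≤ ∫⁻ w in ball z (ε * d), ENNReal.ofReal (1 / ‖y - w‖ ^ ((N : ℝ) + s * 2)) := by
        refine setLIntegral_mono' measurableSet_ball fun w hw => ?_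
        have hw1 := hz1 hw
        have hw2 := hz2 hw
        rw [mem_closedBall, dist_comm, dist_eq_norm] at hw2
        have hpos : 0 < ‖y - w‖ := by
          rw [norm_pos_iff, sub_ne_zero]
          rintro rfl
          exact hw1 hy
        refine ENNReal.ofReal_le_ofReal ?_
        rw [Real.rpow_neg (by positivity), ← one_div]
        gcongr
    _ ≤ _ := lintegral_mono_set hz1

/-! ### Cutoffs near the boundary -/

/-- The cutoff `min 1 (k d - 1)₊` as a function of the distance `d` to the boundary. -/
noncomputable def cutoffProfile (k t : ℝ) : ℝ := min 1 (max 0 (k * t - 1))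

lemma cutoffProfile_nonneg (k t : ℝ) : 0 ≤ cutoffProfile k t := le_min zero_le_one (le_max_left _ _)

lemma cutoffProfile_le_one (k t : ℝ) : cutoffProfile k t ≤ 1 := min_le_left _ _

lemma cutoffProfile_of_le {k t : ℝ} (h : k * t ≤ 1) : cutoffProfile k t = 0 := by
  rw [cutoffProfile, max_eq_left (by linarith), min_eq_right zero_le_one]

lemma cutoffProfile_of_ge {k t : ℝ} (h : 2 ≤ k * t) : cutoffProfile k t = 1 := by
  rw [cutoffProfile, max_eq_right (by linarith), min_eq_left (by linarith)]

lemma continuous_cutoffProfile (k : ℝ) : Continuous (cutoffProfile k) := by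
  unfold cutoffProfile; fun_prop

lemma cutoffProfile_mono {k a b : ℝ} (hk : 0 ≤ k) (h : a ≤ b) :
    cutoffProfile k a ≤ cutoffProfile k b := by
  unfold cutoffProfile; gcongr

/-- The slope is at most k, and the profile varies only where k t ≤ 2, so a factor k b can be traded
for 2. The bound no longer contains k, which makes the energy estimate uniform in the scale. -/
lemma cutoffProfile_sub_le {k a b : ℝ} (hk : 0 ≤ k) (ha : 0 ≤ a) (hab : a ≤ b) :
    (cutoffProfile k b - cutoffProfile k a) * b ≤ 2 * (b - a) := by
  have hb : 0 ≤ b := ha.trans hab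
  have hm := cutoffProfile_mono hk hab
  rcases le_total 2 (k * a) with h1 | h1
  · rw [cutoffProfile_of_ge h1, cutoffProfile_of_ge (h1.trans (by gcongr))]
    linarith
  have hlow : k * a - 1 ≤ cutoffProfile k a := le_min (by linarith) (le_max_right _ _)
  rcases le_total 2 (k * b) with h2 | h2
  · have h3 := cutoffProfile_le_one k b
    calc (cutoffProfile k b - cutoffProfile k a) * b ≤ (2 - k * a) * b :=
          mul_le_mul_of_nonneg_right (by linarith) hb
      _ = 2 * b - (k * b) * a := by ring
      _ ≤ 2 * b - 2 * a := by gcongr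
      _ = _ := by ring
  · have h3 : cutoffProfile k b - cutoffProfile k a ≤ k * (b - a) := by
      rcases le_total (k * b) 1 with h4 | h4
      · rw [cutoffProfile_of_le h4]
        have := cutoffProfile_nonneg k a
        have : 0 ≤ k * (b - a) := mul_nonneg hk (by linarith)
        linarith
      · have : cutoffProfile k b ≤ k * b - 1 :=
          (min_le_right _ _).trans (max_le (by linarith) le_rfl)
        linarith
    calc (cutoffProfile k b - cutoffProfile k a) * b ≤ k * (b - a) * b := by gcongr
      _ = (k * b) * (b - a) := by ring
      _ ≤ 2 * (b - a) := by gcongr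

lemma abs_cutoffProfile_sub_le {k a b : ℝ} (hk : 0 ≤ k) (ha : 0 ≤ a) (hb : 0 < b) :
    |cutoffProfile k a - cutoffProfile k b| ≤ 2 * |a - b| / b := by
  rw [le_div_iff₀ hb]
  rcases le_total a b with h | h
  · rw [abs_sub_comm, abs_of_nonneg (sub_nonneg.2 (cutoffProfile_mono hk h)), abs_sub_comm a b,
      abs_of_nonneg (sub_nonneg.2 h)]
    exact cutoffProfile_sub_le hk ha h
  · rw [abs_of_nonneg (sub_nonneg.2 (cutoffProfile_mono hk h)), abs_of_nonneg (sub_nonneg.2 h)]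
    refine le_trans ?_ (cutoffProfile_sub_le hk hb.le h)
    gcongr
    exact sub_nonneg.2 (cutoffProfile_mono hk h)

/-- The quadratic factor leaves order N - (2 - 2s) at the origin, integrable because s < 1; the tail
is integrable because s > 0. -/
lemma lintegral_min_one_kernel_lt_top {N : ℕ} (hN : 1 ≤ N) {s : ℝ} (hs0 : 0 < s) (hs1 : s < 1) :
    ∫⁻ h : RN N, ENNReal.ofReal (min 1 (4 * ‖h‖ ^ 2) / ‖h‖ ^ ((N : ℝ) + s * 2)) < ⊤ := by
  rw [← lintegral_add_compl _ (measurableSet_ball (x := (0 : RN N)) (ε := 1))]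
  refine ENNReal.add_lt_top.2 ⟨?_, ?_⟩
  · calc _ ≤ ∫⁻ h in ball (0 : RN N) 1, 4 * ENNReal.ofReal (‖h‖ ^ (-((N : ℝ) - (2 - 2 * s)))) := by
          refine lintegral_mono fun h => ?_
          rw [show (4 : ℝ≥0∞) = ENNReal.ofReal 4 by simp, ← ENNReal.ofReal_mul (by norm_num)]
          refine ENNReal.ofReal_le_ofReal ?_
          rcases (norm_nonneg h).eq_or_lt with h0 | h0
          · rw [← h0]; simp; positivity
          calc _ ≤ 4 * ‖h‖ ^ 2 / ‖h‖ ^ ((N : ℝ) + s * 2) := by gcongr; exact min_le_right _ _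
            _ = _ := by
              rw [mul_div_assoc, ← Real.rpow_natCast, ← Real.rpow_sub h0]
              congr 2; push_cast; ring
      _ = 4 * _ := lintegral_const_mul' _ _ (by simp)
      _ < ⊤ := ENNReal.mul_lt_top (by simp) (lintegral_ball_norm_rpow_lt_top hN (by linarith) 1)
  · refine lt_of_le_of_lt ?_ (lintegral_compl_ball_norm_rpow_lt_top hN
      (show (N : ℝ) < N + s * 2 by linarith))
    refine lintegral_mono fun h => ENNReal.ofReal_le_ofReal ?_
    rw [Real.rpow_neg (norm_nonneg _), ← one_div]
    gcongr
    exact min_le_left _ _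

/-- The substitution x - y = d h produces d^N from the volume and d^{-N-2s} from the kernel. -/
lemma lintegral_min_one_kernel_scale {N : ℕ} {s d : ℝ} (hd : 0 < d) (y : RN N) :
    ∫⁻ x : RN N, ENNReal.ofReal (min 1 (4 * ‖x - y‖ ^ 2 / d ^ 2) / ‖x - y‖ ^ ((N : ℝ) + s * 2)) =
      ENNReal.ofReal (d ^ (-(2 * s))) *
        ∫⁻ h : RN N, ENNReal.ofReal (min 1 (4 * ‖h‖ ^ 2) / ‖h‖ ^ ((N : ℝ) + s * 2)) := by
  set F : RN N → ℝ≥0∞ := fun h =>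
    ENNReal.ofReal (min 1 (4 * ‖h‖ ^ 2) / ‖h‖ ^ ((N : ℝ) + s * 2)) with hF
  have hFm : Measurable F := by fun_prop
  have h1 : ∫⁻ h : RN N, F (d⁻¹ • h) = ENNReal.ofReal (d ^ (N : ℝ)) * ∫⁻ h, F h := by
    have h2 := lintegral_map (μ := (volume : Measure (RN N))) hFm
      (measurable_const_smul (d⁻¹ : ℝ))
    rw [Measure.map_addHaar_smul _ (inv_ne_zero hd.ne'), lintegral_smul_measure, finrank_RN] at h2
    rw [← h2, smul_eq_mul]
    congr 2
    rw [inv_pow, inv_inv, abs_of_nonneg (by positivity), Real.rpow_natCast]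
  rw [lintegral_sub_right_eq_self (fun x : RN N => ENNReal.ofReal
    (min 1 (4 * ‖x‖ ^ 2 / d ^ 2) / ‖x‖ ^ ((N : ℝ) + s * 2))) y]
  rw [show -(2 * s) = -((N : ℝ) + s * 2) + N by ring, Real.rpow_add hd,
    ENNReal.ofReal_mul (by positivity), mul_assoc, ← h1, ← lintegral_const_mul' _ _ (by simp)]
  refine lintegral_congr fun h => ?_
  rw [hF, ← ENNReal.ofReal_mul (by positivity)]
  congr 1
  rw [norm_smul, norm_inv, Real.norm_of_nonneg hd.le,
    Real.mul_rpow (by positivity) (norm_nonneg _), Real.inv_rpow hd.le, Real.rpow_neg hd.le]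
  have : (0:ℝ) < d ^ ((N : ℝ) + s * 2) := by positivity
  rw [show 4 * (d⁻¹ * ‖h‖) ^ 2 = 4 * ‖h‖ ^ 2 / d ^ 2 by field_simp]
  rcases (norm_nonneg h).eq_or_lt with h0 | h0
  · rw [← h0]; simp
  · field_simp

lemma ae_prod_fst {N : ℕ} {P : RN N → Prop} (h : ∀ᵐ x : RN N, P x) :
    ∀ᵐ z : RN N × RN N, P z.1 :=
  (Measure.quasiMeasurePreserving_fst (μ := volume) (ν := volume)).ae h

lemma ae_prod_snd {N : ℕ} {P : RN N → Prop} (h : ∀ᵐ x : RN N, P x) :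
    ∀ᵐ z : RN N × RN N, P z.2 :=
  (Measure.quasiMeasurePreserving_snd (μ := volume) (ν := volume)).ae h

lemma gagliardo_congr {N : ℕ} {σ p : ℝ} {u v : RN N → ℝ} (h : u =ᵐ[volume] v) :
    gagliardo σ p u = gagliardo σ p v := by
  refine lintegral_congr_ae ?_
  filter_upwards [ae_prod_fst h, ae_prod_snd h] with z h1 h2
  rw [h1, h2]

/-- Multiplication by cutoffs of the distance to the boundary is bounded in `H₀ˢ(Ω)`, uniformly
in the scale of the cutoff. -/
lemma exists_gagliardo_cutoff_le {N : ℕ} (hN : 1 ≤ N) {Ω : Set (RN N)}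
    (hΩo : IsOpen Ω) (hΩb : Bornology.IsBounded Ω) (hΩr : HasC2Boundary Ω) {s : ℝ} (hs0 : 0 < s)
    (hs1 : s < 1) {v : RN N → ℝ} (hv : Measurable v) (hv0 : ∀ᵐ x, x ∉ Ω → v x = 0)
    (hvg : gagliardo s 2 v < ⊤) :
    ∃ C : ℝ≥0∞, C ≠ ⊤ ∧ ∀ k : ℝ, 0 ≤ k →
      gagliardo s 2 (fun x => cutoffProfile k (infDist x Ωᶜ) * v x) ≤ C := by
  obtain ⟨C₁, hC₁, hH⟩ := exists_infDist_rpow_le_lintegral_compl hN hΩo hΩb hΩr hs0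
  have hC₀ := lintegral_min_one_kernel_lt_top hN hs0 hs1
  set C₀ := ∫⁻ h : RN N, ENNReal.ofReal (min 1 (4 * ‖h‖ ^ 2) / ‖h‖ ^ ((N : ℝ) + s * 2)) with hC₀d
  refine ⟨2 * gagliardo s 2 v + 2 * (C₀ * C₁ * gagliardo s 2 v), ?_, fun k hk => ?_⟩
  · exact ENNReal.add_ne_top.2 ⟨ENNReal.mul_ne_top (by simp) hvg.ne, ENNReal.mul_ne_top (by simp)
      (ENNReal.mul_ne_top (ENNReal.mul_ne_top hC₀.ne hC₁) hvg.ne)⟩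
  set d : RN N → ℝ := fun x => infDist x Ωᶜ with hd
  have hdm : Measurable d := (continuous_infDist_pt _).measurable
  set W : RN N × RN N → ℝ≥0∞ := fun z => ENNReal.ofReal (v z.2 ^ 2) *
    ENNReal.ofReal (min 1 (4 * ‖z.1 - z.2‖ ^ 2 / d z.2 ^ 2) / ‖z.1 - z.2‖ ^ ((N : ℝ) + s * 2))
    with hW
  have hWm : Measurable W := by fun_prop
  have hgm : Measurable fun z : RN N × RN N =>
      ENNReal.ofReal (|v z.1 - v z.2| ^ (2:ℝ) / ‖z.1 - z.2‖ ^ ((N : ℝ) + s * 2)) := by fun_prop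
  have hpt : ∀ᵐ z : RN N × RN N, ENNReal.ofReal
      (|cutoffProfile k (d z.1) * v z.1 - cutoffProfile k (d z.2) * v z.2| ^ (2:ℝ) /
        ‖z.1 - z.2‖ ^ ((N : ℝ) + s * 2)) ≤
      2 * ENNReal.ofReal (|v z.1 - v z.2| ^ (2:ℝ) / ‖z.1 - z.2‖ ^ ((N : ℝ) + s * 2))
        + 2 * W z := by
    filter_upwards [ae_prod_snd hv0] with z hz
    have hη : |cutoffProfile k (d z.1) - cutoffProfile k (d z.2)| ^ 2 * v z.2 ^ 2 ≤
        v z.2 ^ 2 * min 1 (4 * ‖z.1 - z.2‖ ^ 2 / d z.2 ^ 2) := by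
      by_cases hzΩ : z.2 ∈ Ω
      · have hdp : 0 < d z.2 := infDist_compl_pos hN hΩo hΩb hzΩ
        rw [mul_comm]
        gcongr
        refine le_min ?_ ?_
        · have h1 := cutoffProfile_nonneg k (d z.1)
          have h2 := cutoffProfile_nonneg k (d z.2)
          have h3 := cutoffProfile_le_one k (d z.1)
          have h4 := cutoffProfile_le_one k (d z.2)
          rw [sq_le_one_iff₀ (abs_nonneg _), abs_le]
          constructor <;> linarith
        · have h1 := abs_cutoffProfile_sub_le hk (infDist_nonneg (x := z.1) (s := Ωᶜ)) hdp
          have h2 : |d z.1 - d z.2| ≤ ‖z.1 - z.2‖ := by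
            have := (lipschitz_infDist_pt Ωᶜ).dist_le_mul z.1 z.2
            simpa [Real.dist_eq, dist_eq_norm] using this
          calc _ ≤ (2 * |d z.1 - d z.2| / d z.2) ^ 2 := by gcongr
            _ ≤ (2 * ‖z.1 - z.2‖ / d z.2) ^ 2 := by gcongr
            _ = _ := by ring
      · rw [hz hzΩ]; simp
    have h2 : ∀ r : ℝ, (2 : ℝ≥0∞) * ENNReal.ofReal r = ENNReal.ofReal (2 * r) := fun r => by
      rw [ENNReal.ofReal_mul (by norm_num), ENNReal.ofReal_ofNat]
    simp only [hW]
    rw [← ENNReal.ofReal_mul (sq_nonneg _), h2, h2,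
      ← ENNReal.ofReal_add (by positivity) (by positivity)]
    refine ENNReal.ofReal_le_ofReal ?_
    rw [mul_div_assoc', mul_div_assoc', mul_div_assoc', ← add_div]
    gcongr
    rw [Real.rpow_two, Real.rpow_two, sq_abs, sq_abs]
    rw [sq_abs] at hη
    set a := cutoffProfile k (d z.1) with ha
    set b := cutoffProfile k (d z.2) with hb
    have ha2 : a ^ 2 ≤ 1 := by
      rw [sq_le_one_iff₀ (cutoffProfile_nonneg _ _)]
      exact cutoffProfile_le_one _ _
    calc (a * v z.1 - b * v z.2) ^ 2 = (a * (v z.1 - v z.2) + (a - b) * v z.2) ^ 2 := by ring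
      _ ≤ 2 * (a ^ 2 * (v z.1 - v z.2) ^ 2) + 2 * ((a - b) ^ 2 * v z.2 ^ 2) := by
          nlinarith [sq_nonneg (a * (v z.1 - v z.2) - (a - b) * v z.2)]
      _ ≤ 2 * (1 * (v z.1 - v z.2) ^ 2) +
            2 * (v z.2 ^ 2 * min 1 (4 * ‖z.1 - z.2‖ ^ 2 / d z.2 ^ 2)) := by gcongr
      _ = _ := by ring
  -- For fixed y in Ω the x-integral scales to C₀ d(y)^{-2s}, which the exterior kernel mass
  -- dominates up to C₁. Since v = 0 outside Ω, v(y)² equals |v(y)-v(z)|² for exterior z, and the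
  -- Gagliardo energy of v reappears.
  have hWi : ∫⁻ z, W z ≤ C₀ * C₁ * gagliardo s 2 v := by
    calc ∫⁻ z, W z = ∫⁻ y, ∫⁻ x, W (x, y) := by
          rw [Measure.volume_eq_prod, lintegral_prod_symm _ hWm.aemeasurable]
      _ ≤ ∫⁻ y, C₀ * C₁ * ∫⁻ z, ENNReal.ofReal
            (|v y - v z| ^ (2:ℝ) / ‖y - z‖ ^ ((N : ℝ) + s * 2)) := by
          refine lintegral_mono_ae ?_
          filter_upwards [hv0] with y hy
          by_cases hyΩ : y ∈ Ω
          · have hdp : 0 < d y := infDist_compl_pos hN hΩo hΩb hyΩ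
            simp only [hW]
            rw [lintegral_const_mul' _ _ ENNReal.ofReal_ne_top, lintegral_min_one_kernel_scale hdp]
            calc _ ≤ ENNReal.ofReal (v y ^ 2) *
                  ((C₁ * ∫⁻ z in Ωᶜ, ENNReal.ofReal (1 / ‖y - z‖ ^ ((N : ℝ) + s * 2))) * C₀) := by
                    gcongr
                    exact hH y hyΩ
              _ = C₀ * C₁ * ∫⁻ z in Ωᶜ, ENNReal.ofReal (v y ^ 2) *
                    ENNReal.ofReal (1 / ‖y - z‖ ^ ((N : ℝ) + s * 2)) := by
                    rw [lintegral_const_mul' _ _ ENNReal.ofReal_ne_top]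
                    ring
              _ = C₀ * C₁ * ∫⁻ z in Ωᶜ, ENNReal.ofReal
                    (|v y - v z| ^ (2:ℝ) / ‖y - z‖ ^ ((N : ℝ) + s * 2)) := by
                    congr 1
                    refine setLIntegral_congr_fun_ae hΩo.measurableSet.compl ?_
                    filter_upwards [hv0] with z hz hzΩ
                    rw [hz hzΩ, sub_zero, Real.rpow_two, sq_abs,
                      ← ENNReal.ofReal_mul (sq_nonneg _), mul_one_div]
              _ ≤ _ := by
                    gcongr
                    exact Measure.restrict_le_self
          · simp [hW, hy hyΩ]
      _ = C₀ * C₁ * gagliardo s 2 v := by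
          rw [lintegral_const_mul' _ _ (ENNReal.mul_ne_top hC₀.ne hC₁), gagliardo,
            Measure.volume_eq_prod, lintegral_prod _ hgm.aemeasurable]
  calc _ ≤ ∫⁻ z : RN N × RN N, (2 * ENNReal.ofReal
        (|v z.1 - v z.2| ^ (2:ℝ) / ‖z.1 - z.2‖ ^ ((N : ℝ) + s * 2)) + 2 * W z) :=
        lintegral_mono_ae hpt
    _ = 2 * gagliardo s 2 v + 2 * ∫⁻ z, W z := by
        rw [lintegral_add_left (by fun_prop), lintegral_const_mul' _ _ (by simp),
          lintegral_const_mul' _ _ (by simp), gagliardo]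
    _ ≤ _ := by gcongr

/-! ### Mollification -/

/-- The variance of f under the probability density ρ is nonnegative. -/
lemma sq_integral_mul_le {X : Type*} [MeasurableSpace X] {ν : Measure X} {ρ f : X → ℝ} {M : ℝ}
    (hρ : Integrable ρ ν) (hρ0 : ∀ x, 0 ≤ ρ x) (hρ1 : ∫ x, ρ x ∂ν = 1) (hf : Measurable f)
    (hfM : ∀ x, |f x| ≤ M) : (∫ x, ρ x * f x ∂ν) ^ 2 ≤ ∫ x, ρ x * f x ^ 2 ∂ν := by
  have h1 : Integrable (fun x => ρ x * f x) ν :=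
    hρ.mul_bdd (c := M) hf.aestronglyMeasurable (Eventually.of_forall hfM)
  have h2 : Integrable (fun x => ρ x * f x ^ 2) ν := by
    refine hρ.mul_bdd (c := M ^ 2) (hf.pow_const 2).aestronglyMeasurable
      (Eventually.of_forall fun x => ?_)
    rw [Real.norm_eq_abs, abs_pow]
    gcongr
    exact hfM x
  set m := ∫ x, ρ x * f x ∂ν
  have h3 : 0 ≤ ∫ x, (ρ x * f x ^ 2 - 2 * m * (ρ x * f x) + m ^ 2 * ρ x) ∂ν := by
    refine integral_nonneg fun x => ?_
    have : ρ x * f x ^ 2 - 2 * m * (ρ x * f x) + m ^ 2 * ρ x = ρ x * (f x - m) ^ 2 := by ring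
    simp only [Pi.zero_apply, this]
    exact mul_nonneg (hρ0 x) (sq_nonneg _)
  rw [integral_add (f := fun x => ρ x * f x ^ 2 - 2 * m * (ρ x * f x))
    (h2.sub (h1.const_mul _)) (hρ.const_mul _), integral_sub h2 (h1.const_mul _),
    integral_const_mul, integral_const_mul, hρ1] at h3
  nlinarith

lemma gagliardo_two_comp_sub {N : ℕ} (s : ℝ) (φ : RN N → ℝ) (h : RN N) :
    gagliardo s 2 (fun x => φ (x - h)) = gagliardo s 2 φ := by
  have : (volume : Measure (RN N × RN N)).IsAddRightInvariant :=
    inferInstanceAs ((volume : Measure (RN N)).prod volume).IsAddRightInvariant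
  have := lintegral_sub_right_eq_self (μ := (volume : Measure (RN N × RN N)))
    (fun z : RN N × RN N =>
      ENNReal.ofReal (|φ z.1 - φ z.2| ^ (2:ℝ) / ‖z.1 - z.2‖ ^ ((N : ℝ) + s * 2))) (h, h)
  rw [gagliardo, gagliardo, ← this]
  refine lintegral_congr fun z => ?_
  simp

/-- The convolution averages translates of φ against a probability density. Jensen's inequality
applies pointwise to the squared difference, and after Tonelli each translate has the energy of φ.
-/
lemma gagliardo_convolution_le {N : ℕ} {s : ℝ} {φ ρ : RN N → ℝ} (hφ : Measurable φ)
    (hφ1 : ∀ x, |φ x| ≤ 1) (hρm : Measurable ρ) (hρ : Integrable ρ) (hρ0 : ∀ x, 0 ≤ ρ x)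
    (hρ1 : ∫ x, ρ x = 1) :
    gagliardo s 2 (fun x => ∫ h, ρ h * φ (x - h)) ≤ gagliardo s 2 φ := by
  have hpt : ∀ z : RN N × RN N, ENNReal.ofReal (|(∫ h, ρ h * φ (z.1 - h)) -
      ∫ h, ρ h * φ (z.2 - h)| ^ (2:ℝ) / ‖z.1 - z.2‖ ^ ((N : ℝ) + s * 2)) ≤
      ∫⁻ h, ENNReal.ofReal (ρ h) * ENNReal.ofReal
        (|φ (z.1 - h) - φ (z.2 - h)| ^ (2:ℝ) / ‖z.1 - z.2‖ ^ ((N : ℝ) + s * 2)) := by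
    intro z
    have hi : ∀ x : RN N, Integrable (fun h => ρ h * φ (x - h)) := fun x =>
      hρ.mul_bdd (c := 1) (show Measurable fun h => φ (x - h) by fun_prop).aestronglyMeasurable
        (Eventually.of_forall fun h => hφ1 _)
    have hb : ∀ h : RN N, |φ (z.1 - h) - φ (z.2 - h)| ≤ 2 := fun h => by
      have h1 := abs_le.1 (hφ1 (z.1 - h))
      have h2 := abs_le.1 (hφ1 (z.2 - h))
      rw [abs_le]
      constructor <;> linarith [h1.1, h1.2, h2.1, h2.2]
    rw [← integral_sub (hi _) (hi _)]
    simp_rw [← mul_sub]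
    have hmf : Measurable fun h => φ (z.1 - h) - φ (z.2 - h) := by fun_prop
    have h1 := sq_integral_mul_le hρ hρ0 hρ1 hmf hb
    have h2 : Integrable (fun h => ρ h * (φ (z.1 - h) - φ (z.2 - h)) ^ 2) := by
      refine hρ.mul_bdd (c := 2 ^ 2) (hmf.pow_const 2).aestronglyMeasurable
        (Eventually.of_forall fun h => ?_)
      rw [Real.norm_eq_abs, abs_pow]
      gcongr
      exact hb h
    rw [Real.rpow_two, sq_abs]
    calc _ ≤ ENNReal.ofReal ((∫ h, ρ h * (φ (z.1 - h) - φ (z.2 - h)) ^ 2) /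
          ‖z.1 - z.2‖ ^ ((N : ℝ) + s * 2)) := by gcongr
      _ = ENNReal.ofReal (∫ h, ρ h * (φ (z.1 - h) - φ (z.2 - h)) ^ 2 /
          ‖z.1 - z.2‖ ^ ((N : ℝ) + s * 2)) := by rw [integral_div]
      _ = ∫⁻ h, ENNReal.ofReal (ρ h * (φ (z.1 - h) - φ (z.2 - h)) ^ 2 /
          ‖z.1 - z.2‖ ^ ((N : ℝ) + s * 2)) := by
          refine ofReal_integral_eq_lintegral_ofReal (h2.div_const _)
            (Eventually.of_forall fun h => ?_)
          have := hρ0 h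
          simp only [Pi.zero_apply]
          positivity
      _ = _ := by
          refine lintegral_congr fun h => ?_
          rw [← ENNReal.ofReal_mul (hρ0 h), Real.rpow_two, sq_abs, mul_div_assoc]
  calc _ ≤ ∫⁻ z : RN N × RN N, ∫⁻ h, ENNReal.ofReal (ρ h) * ENNReal.ofReal
        (|φ (z.1 - h) - φ (z.2 - h)| ^ (2:ℝ) / ‖z.1 - z.2‖ ^ ((N : ℝ) + s * 2)) :=
        lintegral_mono hpt
    _ = ∫⁻ h, ∫⁻ z : RN N × RN N, ENNReal.ofReal (ρ h) * ENNReal.ofReal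
        (|φ (z.1 - h) - φ (z.2 - h)| ^ (2:ℝ) / ‖z.1 - z.2‖ ^ ((N : ℝ) + s * 2)) := by
        refine lintegral_lintegral_swap (Measurable.aemeasurable ?_)
        simp only [Function.uncurry_def]
        fun_prop
    _ = ∫⁻ h, ENNReal.ofReal (ρ h) * gagliardo s 2 φ := by
        refine lintegral_congr fun h => ?_
        rw [lintegral_const_mul' _ _ ENNReal.ofReal_ne_top, ← gagliardo_two_comp_sub s φ h]
        rfl
    _ = gagliardo s 2 φ := by
        rw [lintegral_mul_const _ (by fun_prop), ← ofReal_integral_eq_lintegral_ofReal hρ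
          (Eventually.of_forall hρ0), hρ1]
        simp

/-- A bounded function with compact support in `Ω` is an almost everywhere limit of test functions
with no larger supremum and no larger Gagliardo energy. -/
lemma exists_isTestFunction_tendsto {N : ℕ} {Ω K : Set (RN N)} (hΩo : IsOpen Ω) (hK : IsCompact K)
    (hKΩ : K ⊆ Ω) {s : ℝ} {φ : RN N → ℝ} (hφ : Measurable φ) (hφ1 : ∀ x, |φ x| ≤ 1)
    (hφK : ∀ x, x ∉ K → φ x = 0) :
    ∃ ψ : ℕ → RN N → ℝ, (∀ j, IsTestFunction Ω (ψ j)) ∧ (∀ j x, |ψ j x| ≤ 1) ∧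
      (∀ j, gagliardo s 2 (ψ j) ≤ gagliardo s 2 φ) ∧
      ∀ᵐ x, Tendsto (fun j => ψ j x) atTop (𝓝 (φ x)) := by
  obtain ⟨δ, hδ, hδΩ⟩ := hK.exists_cthickening_subset_open hΩo hKΩ
  -- The outer radius stays at most δ, so supports remain in the thickening of K inside Ω. The fixed
  -- ratio 2 of the radii is what the almost everywhere convergence below requires.
  let B : ℕ → ContDiffBump (0 : RN N) := fun j =>
    ⟨δ / (j + 1) / 2, δ / (j + 1), by positivity, half_lt_self (by positivity)⟩
  have hφi : LocallyIntegrable φ := by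
    refine (locallyIntegrable_const (1:ℝ)).mono
      hφ.aestronglyMeasurable (Eventually.of_forall fun x => ?_)
    simpa using hφ1 x
  refine ⟨fun j => (B j).normed volume ⋆[ContinuousLinearMap.lsmul ℝ ℝ, volume] φ, ?_, ?_, ?_, ?_⟩
  · intro j
    have hsub : tsupport ((B j).normed volume ⋆[ContinuousLinearMap.lsmul ℝ ℝ, volume] φ) ⊆
        cthickening δ K := by
      refine closure_minimal ?_ isClosed_cthickening
      refine (support_convolution_subset _).trans ?_
      rintro x ⟨a, ha, c, hc, rfl⟩
      have hcK : c ∈ K := by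
        by_contra h
        exact hc (hφK c h)
      rw [(B j).support_normed_eq, mem_ball_zero_iff] at ha
      refine mem_cthickening_of_dist_le _ c δ K hcK ?_
      rw [dist_eq_norm, add_sub_cancel_right]
      refine ha.le.trans ?_
      change δ / ((j : ℝ) + 1) ≤ δ
      exact div_le_self hδ.le (by linarith [Nat.cast_nonneg (α := ℝ) j])
    refine ⟨?_, ?_, hsub.trans hδΩ⟩
    · exact HasCompactSupport.contDiff_convolution_left _ (B j).hasCompactSupport_normed
        (B j).contDiff_normed hφi
    · exact hK.cthickening.of_isClosed_subset (isClosed_tsupport _) hsub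
  · intro j x
    simp only [convolution_def]
    rw [← Real.norm_eq_abs]
    refine (norm_integral_le_of_norm_le ((B j).integrable_normed)
      (Eventually.of_forall fun h => ?_)).trans_eq ((B j).integral_normed)
    rw [ContinuousLinearMap.lsmul_apply, norm_smul, Real.norm_of_nonneg ((B j).nonneg_normed _)]
    exact mul_le_of_le_one_right ((B j).nonneg_normed _) (hφ1 _)
  · intro j
    exact gagliardo_convolution_le hφ hφ1 (B j).continuous_normed.measurable
      (B j).integrable_normed (B j).nonneg_normed (B j).integral_normed
  · refine ContDiffBump.ae_convolution_tendsto_right_of_locallyIntegrable (K := 2) ?_ ?_ hφi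
    · have := tendsto_one_div_add_atTop_nhds_zero_nat (𝕜 := ℝ)
      have := this.const_mul δ
      simpa [B, div_eq_mul_inv] using this
    · refine Eventually.of_forall fun j => ?_
      change δ / ((j : ℝ) + 1) ≤ 2 * (δ / (j + 1) / 2)
      linarith

/-! ### L¹ bounds for the Hardy and Choquard terms -/

lemma lintegral_sub_rpow_le {N : ℕ} {Ω : Set (RN N)} {R : ℝ} (hR : Ω ⊆ ball 0 R) (t : ℝ) {y : RN N}
    (hy : y ∈ Ω) : ∫⁻ x in Ω, ENNReal.ofReal (‖x - y‖ ^ (-t)) ≤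
      ∫⁻ h in ball (0 : RN N) (2 * R), ENNReal.ofReal (‖h‖ ^ (-t)) := by
  calc ∫⁻ x in Ω, ENNReal.ofReal (‖x - y‖ ^ (-t))
      ≤ ∫⁻ x in ball y (2 * R), ENNReal.ofReal (‖x - y‖ ^ (-t)) := by
        refine lintegral_mono_set fun x hx => ?_
        have h1 := mem_ball_zero_iff.1 (hR hx)
        have h2 := mem_ball_zero_iff.1 (hR hy)
        rw [mem_ball, dist_eq_norm]
        linarith [norm_sub_le x y]
    _ = ∫⁻ x : RN N, (ball (0 : RN N) (2 * R)).indicator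
          (fun h => ENNReal.ofReal (‖h‖ ^ (-t))) (x - y) := by
        rw [← lintegral_indicator measurableSet_ball]
        refine lintegral_congr fun x => ?_
        by_cases hx : x ∈ ball y (2 * R)
        · rw [indicator_of_mem hx, indicator_of_mem]
          rwa [mem_ball_zero_iff, ← dist_eq_norm]
        · rw [indicator_of_notMem hx, indicator_of_notMem]
          rwa [mem_ball_zero_iff, ← dist_eq_norm]
    _ = _ := by
        rw [lintegral_sub_right_eq_self, lintegral_indicator measurableSet_ball]

lemma rpow_le_one_add_rpow {x q r : ℝ} (hx : 0 ≤ x) (hq : 0 ≤ q) (hqr : q ≤ r) :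
    x ^ q ≤ 1 + x ^ r := by
  rcases le_total x 1 with h | h
  · have := Real.rpow_le_one hx h hq
    have := Real.rpow_nonneg hx r
    linarith
  · have := Real.rpow_le_rpow_of_exponent_le h hqr
    linarith

lemma lintegral_one_add_le {N : ℕ} {Ω : Set (RN N)} {w : RN N → ℝ} (hw : ∀ x, 0 ≤ w x)
    (hI : ∫⁻ x in Ω, ENNReal.ofReal (w x) ≤ 1) :
    ∫⁻ x in Ω, ENNReal.ofReal (1 + w x) ≤ volume Ω + 1 := by
  calc _ = ∫⁻ x in Ω, (1 + ENNReal.ofReal (w x)) := by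
        refine lintegral_congr fun x => ?_
        rw [ENNReal.ofReal_add zero_le_one (hw x), ENNReal.ofReal_one]
    _ = volume Ω + ∫⁻ x in Ω, ENNReal.ofReal (w x) := by
        rw [lintegral_add_left measurable_const]; simp
    _ ≤ _ := by gcongr

lemma lintegral_rpow_le {N : ℕ} {Ω : Set (RN N)} {u : RN N → ℝ} {q r : ℝ} (hq : 0 ≤ q)
    (hqr : q ≤ r) (hI : ∫⁻ x in Ω, ENNReal.ofReal (|u x| ^ r) ≤ 1) :
    ∫⁻ x in Ω, ENNReal.ofReal (|u x| ^ q) ≤ volume Ω + 1 := by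
  refine le_trans (lintegral_mono fun x => ?_)
    (lintegral_one_add_le (fun x => Real.rpow_nonneg (abs_nonneg (u x)) r) hI)
  exact ENNReal.ofReal_le_ofReal (rpow_le_one_add_rpow (abs_nonneg _) hq hqr)

/-- The Hardy potential times `u` is bounded in `L¹(Ω)` on the unit ball of `L^{2_s^*}(Ω)`. -/
lemma exists_lintegral_hardy_le {N : ℕ} {Ω : Set (RN N)} (hΩb : Bornology.IsBounded Ω) {s : ℝ}
    (hs0 : 0 < s) (hN : 2 * s < N) :
    ∃ C : ℝ≥0∞, C ≠ ⊤ ∧ ∀ u : RN N → ℝ, ∫⁻ x in Ω, ENNReal.ofReal (|u x| ^ twoStar N s) ≤ 1 →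
      ∫⁻ x in Ω, ENNReal.ofReal (|u x| / ‖x‖ ^ (2 * s)) ≤ C := by
  have hN1 : 1 ≤ N := by
    have : (0:ℝ) < N := by linarith
    exact_mod_cast this
  obtain ⟨R, hR⟩ := hΩb.subset_ball (0 : RN N)
  -- This is the exponent conjugate to 2_s^*; then 2sq < N is equivalent to 2s < N.
  set q : ℝ := 2 * N / (N + 2 * s) with hq
  have hN0 : (0:ℝ) < N := by linarith
  have hNs : (0:ℝ) < N - 2 * s := by linarith
  have hqc : (twoStar N s).HolderConjugate q := by
    rw [Real.holderConjugate_iff]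
    constructor
    · rw [twoStar, one_lt_div hNs]; linarith
    · rw [twoStar, hq]; field_simp; ring
  have ht : 2 * s * q < N := by
    rw [hq, mul_div_assoc', div_lt_iff₀ (by linarith)]
    nlinarith
  have hK := lintegral_ball_norm_rpow_lt_top hN1 ht R
  refine ⟨1 + ∫⁻ x in ball (0 : RN N) R, ENNReal.ofReal (‖x‖ ^ (-(2 * s * q))),
    ENNReal.add_ne_top.2 ⟨by simp, hK.ne⟩, fun u hu => ?_⟩
  calc _ ≤ ∫⁻ x in Ω, (ENNReal.ofReal (|u x| ^ twoStar N s) +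
        ENNReal.ofReal (‖x‖ ^ (-(2 * s * q)))) := by
        refine lintegral_mono fun x => ?_
        simp only
        rw [← ENNReal.ofReal_add (by positivity) (by positivity)]
        refine ENNReal.ofReal_le_ofReal ?_
        have h := Real.young_inequality_of_nonneg (abs_nonneg (u x))
          (show 0 ≤ ‖x‖ ^ (-(2 * s)) by positivity) hqc
        rw [← Real.rpow_mul (norm_nonneg _)] at h
        rw [div_eq_mul_inv, ← Real.rpow_neg (norm_nonneg _)]
        refine h.trans (add_le_add ?_ ?_)
        · exact div_le_self (by positivity) hqc.lt.le
        · rw [neg_mul]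
          exact div_le_self (by positivity) hqc.symm.lt.le
    _ = _ := by rw [lintegral_add_right _ (by fun_prop)]
    _ ≤ _ := add_le_add hu (lintegral_mono_set hR)

/-- Weighted AM-GM on XY, Yk, Xk with weights a+c-1, 1-c, 1-a. It stands in for the
Hardy-Littlewood-Sobolev inequality: with k a power of the distance, each pairwise product is
integrable over Ω × Ω by Fubini. -/
lemma rpow_mul_rpow_mul_rpow_le {X Y k a c : ℝ} (hX : 0 ≤ X) (hY : 0 ≤ Y) (hk : 0 ≤ k)
    (ha0 : 1 / 2 ≤ a) (ha1 : a ≤ 1) (hc0 : 1 / 2 ≤ c) (hc1 : c ≤ 1) :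
    Y ^ a * X ^ c * k ^ (2 - a - c) ≤ X * Y + Y * k + X * k := by
  have h := Real.geom_mean_le_arith_mean3_weighted (w₁ := a + c - 1) (w₂ := 1 - c) (w₃ := 1 - a)
    (p₁ := X * Y) (p₂ := Y * k) (p₃ := X * k) (by linarith) (by linarith) (by linarith)
    (by positivity) (by positivity) (by positivity) (by ring)
  rw [Real.mul_rpow hX hY, Real.mul_rpow hY hk, Real.mul_rpow hX hk] at h
  have e1 : Y ^ a = Y ^ (a + c - 1) * Y ^ (1 - c) := by
    rw [← Real.rpow_add_of_nonneg hY (by linarith) (by linarith)]; congr 1; ring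
  have e2 : X ^ c = X ^ (a + c - 1) * X ^ (1 - a) := by
    rw [← Real.rpow_add_of_nonneg hX (by linarith) (by linarith)]; congr 1; ring
  have e3 : k ^ (2 - a - c) = k ^ (1 - c) * k ^ (1 - a) := by
    rw [← Real.rpow_add_of_nonneg hk (by linarith) (by linarith)]; congr 1; ring
  rw [e1, e2, e3]
  have h1 : (a + c - 1) * (X * Y) ≤ X * Y := mul_le_of_le_one_left (by positivity) (by linarith)
  have h2 : (1 - c) * (Y * k) ≤ Y * k := mul_le_of_le_one_left (by positivity) (by linarith)
  have h3 : (1 - a) * (X * k) ≤ X * k := mul_le_of_le_one_left (by positivity) (by linarith)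
  calc _ = X ^ (a + c - 1) * Y ^ (a + c - 1) * (Y ^ (1 - c) * k ^ (1 - c)) *
        (X ^ (1 - a) * k ^ (1 - a)) := by ring
    _ ≤ _ := h
    _ ≤ _ := by linarith

/-- The Choquard nonlinearity is bounded in `L¹(Ω)` on the unit ball of `L^{2_s^*}(Ω)`. -/
lemma exists_lintegral_choquard_le {N : ℕ} {Ω : Set (RN N)} (hΩo : IsOpen Ω)
    (hΩb : Bornology.IsBounded Ω) {s b : ℝ} (hs0 : 0 < s) (hN : 2 * s < N) (hb0 : 0 < b)
    (hbN : b < min (N : ℝ) (4 * s)) :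
    ∃ C : ℝ≥0∞, C ≠ ⊤ ∧ ∀ u : RN N → ℝ, AEStronglyMeasurable u volume →
      ∫⁻ x in Ω, ENNReal.ofReal (|u x| ^ twoStar N s) ≤ 1 →
      ∫⁻ z in Ω ×ˢ Ω, ENNReal.ofReal (|u z.2| ^ twoStarB N s b * |u z.1| ^ (twoStarB N s b - 1) /
        ‖z.1 - z.2‖ ^ b) ≤ C := by
  have hN0 : (0:ℝ) < N := by linarith
  have hN1 : 1 ≤ N := by exact_mod_cast hN0
  have hNs : (0:ℝ) < N - 2 * s := by linarith
  have hbN' : b < N := hbN.trans_le (min_le_left _ _)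
  obtain ⟨R, hR⟩ := hΩb.subset_ball (0 : RN N)
  set r := twoStar N s with hr
  set p := twoStarB N s b with hp
  have hr0 : 0 < r := by rw [hr, twoStar]; positivity
  set a : ℝ := p / r with ha
  have hae : a = 1 - b / (2 * N) := by
    rw [ha, hp, hr, twoStar, twoStarB]; field_simp
  have hbN2 : b / (2 * N) < 1 / 2 := by rw [div_lt_iff₀ (by positivity)]; linarith
  have hbN0 : 0 < b / (2 * N) := by positivity
  -- The floor 1/2 keeps the weight a+c-1 nonnegative. Since c < a = 1 - b/(2N), the kernel exponent
  -- satisfies 2-a-c > b/N, hence t < N.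
  set c : ℝ := max ((p - 1) / r) (1 / 2) with hc
  have hc' : (p - 1) / r < a := by
    rw [ha]; gcongr; linarith
  have hca : c < a := max_lt hc' (by linarith)
  have hc2 : 1 / 2 ≤ c := le_max_right _ _
  have hθ : 0 < 2 - a - c := by linarith
  set t := b / (2 - a - c) with ht
  have htN : t < N := by
    rw [ht, div_lt_iff₀ hθ]
    have : b / N < 2 - a - c := by
      have : b / (N : ℝ) = 2 * (b / (2 * N)) := by field_simp
      linarith
    rwa [div_lt_iff₀' hN0] at this
  have hK := lintegral_ball_norm_rpow_lt_top hN1 htN (2 * R)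
  set K := ∫⁻ h in ball (0 : RN N) (2 * R), ENNReal.ofReal (‖h‖ ^ (-t)) with hKd
  set V := volume Ω + 1 with hV
  have hVt : V ≠ ⊤ := ENNReal.add_ne_top.2 ⟨hΩb.measure_lt_top.ne, by simp⟩
  refine ⟨V * V + V * K + V * K, ?_, fun u hum hu => ?_⟩
  · exact ENNReal.add_ne_top.2 ⟨ENNReal.add_ne_top.2 ⟨ENNReal.mul_ne_top hVt hVt,
      ENNReal.mul_ne_top hVt hK.ne⟩, ENNReal.mul_ne_top hVt hK.ne⟩
  -- The added 1 makes F ≥ 1, so exponents of F may be raised freely, in particular from (p-1)/r to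
  -- c.
  set F : RN N → ℝ := fun x => 1 + |u x| ^ r with hF
  have hF1 : ∀ x, 1 ≤ F x := fun x => by
    have := Real.rpow_nonneg (abs_nonneg (u x)) r
    simp only [hF]; linarith
  have hF0 : ∀ x, 0 ≤ F x := fun x => zero_le_one.trans (hF1 x)
  have hFm : AEMeasurable (fun x => ENNReal.ofReal (F x)) (volume.restrict Ω) := by
    have := hum.aemeasurable.restrict (s := Ω)
    exact ((measurable_abs.comp_aemeasurable this).pow_const r).const_add 1 |>.ennreal_ofReal
  have hFV : ∫⁻ x in Ω, ENNReal.ofReal (F x) ≤ V :=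
    lintegral_one_add_le (fun x => Real.rpow_nonneg (abs_nonneg (u x)) r) hu
  have hp1 : 0 ≤ p - 1 := by
    rw [hp, twoStarB, sub_nonneg, one_le_div hNs]; linarith
  have huF : ∀ x e f, 0 ≤ e → e / r ≤ f → |u x| ^ e ≤ F x ^ f := by
    intro x e f he hef
    calc |u x| ^ e = (|u x| ^ r) ^ (e / r) := by
          rw [← Real.rpow_mul (abs_nonneg _), mul_div_cancel₀ _ hr0.ne']
      _ ≤ F x ^ (e / r) := by
          gcongr
          simp only [hF]; linarith
      _ ≤ F x ^ f := Real.rpow_le_rpow_of_exponent_le (hF1 x) hef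
  have hpt : ∀ z : RN N × RN N,
      ENNReal.ofReal (|u z.2| ^ p * |u z.1| ^ (p - 1) / ‖z.1 - z.2‖ ^ b) ≤
      ENNReal.ofReal (F z.1) * ENNReal.ofReal (F z.2) +
        ENNReal.ofReal (F z.2) * ENNReal.ofReal (‖z.1 - z.2‖ ^ (-t)) +
        ENNReal.ofReal (F z.1) * ENNReal.ofReal (‖z.1 - z.2‖ ^ (-t)) := by
    intro z
    have hx := hF0 z.1
    have hy := hF0 z.2
    have hk : 0 ≤ ‖z.1 - z.2‖ ^ (-t) := by positivity
    rw [← ENNReal.ofReal_mul hx, ← ENNReal.ofReal_mul hy, ← ENNReal.ofReal_mul hx,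
      ← ENNReal.ofReal_add (by positivity) (by positivity),
      ← ENNReal.ofReal_add (by positivity) (by positivity)]
    refine ENNReal.ofReal_le_ofReal ?_
    have hbt : (‖z.1 - z.2‖ ^ (-t)) ^ (2 - a - c) = (‖z.1 - z.2‖ ^ b)⁻¹ := by
      rw [← Real.rpow_mul (norm_nonneg _), ← Real.rpow_neg (norm_nonneg _), neg_mul, ht,
        div_mul_cancel₀ _ hθ.ne']
    refine le_trans ?_ (rpow_mul_rpow_mul_rpow_le hx hy hk (a := a) (c := c) (by linarith)
      (by linarith) hc2 (by linarith))
    rw [hbt, div_eq_mul_inv]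
    gcongr
    · exact huF _ _ _ (by linarith) le_rfl
    · exact huF _ _ _ hp1 (le_max_left _ _)
  rw [Measure.volume_eq_prod, ← Measure.prod_restrict]
  set ν := (volume : Measure (RN N)).restrict Ω with hν
  have hkm : Measurable fun z : RN N × RN N => ENNReal.ofReal (‖z.1 - z.2‖ ^ (-t)) := by fun_prop
  have hFfst : AEMeasurable (fun z : RN N × RN N => ENNReal.ofReal (F z.1)) (ν.prod ν) :=
    hFm.comp_quasiMeasurePreserving Measure.quasiMeasurePreserving_fst
  have hFsnd : AEMeasurable (fun z : RN N × RN N => ENNReal.ofReal (F z.2)) (ν.prod ν) :=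
    hFm.comp_quasiMeasurePreserving Measure.quasiMeasurePreserving_snd
  have hA : AEMeasurable (fun z : RN N × RN N => ENNReal.ofReal (F z.1) * ENNReal.ofReal (F z.2))
      (ν.prod ν) := hFfst.mul hFsnd
  have hB : AEMeasurable (fun z : RN N × RN N => ENNReal.ofReal (F z.2) *
      ENNReal.ofReal (‖z.1 - z.2‖ ^ (-t))) (ν.prod ν) := hFsnd.mul hkm.aemeasurable
  have hD : AEMeasurable (fun z : RN N × RN N => ENNReal.ofReal (F z.1) *
      ENNReal.ofReal (‖z.1 - z.2‖ ^ (-t))) (ν.prod ν) := hFfst.mul hkm.aemeasurable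
  calc _ ≤ ∫⁻ z, (ENNReal.ofReal (F z.1) * ENNReal.ofReal (F z.2) +
        ENNReal.ofReal (F z.2) * ENNReal.ofReal (‖z.1 - z.2‖ ^ (-t)) +
        ENNReal.ofReal (F z.1) * ENNReal.ofReal (‖z.1 - z.2‖ ^ (-t))) ∂(ν.prod ν) :=
        lintegral_mono hpt
    _ = ∫⁻ z, ENNReal.ofReal (F z.1) * ENNReal.ofReal (F z.2) ∂(ν.prod ν) +
        ∫⁻ z, ENNReal.ofReal (F z.2) * ENNReal.ofReal (‖z.1 - z.2‖ ^ (-t)) ∂(ν.prod ν) +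
        ∫⁻ z, ENNReal.ofReal (F z.1) * ENNReal.ofReal (‖z.1 - z.2‖ ^ (-t)) ∂(ν.prod ν) := by
        rw [lintegral_add_right' _ hD, lintegral_add_left' hA]
    _ ≤ _ := by
        refine add_le_add (add_le_add ?_ ?_) ?_
        · rw [lintegral_prod_mul hFm hFm]
          gcongr
        · rw [lintegral_prod_symm _ hB]
          calc _ ≤ ∫⁻ y, ENNReal.ofReal (F y) * K ∂ν := by
                refine setLIntegral_mono' hΩo.measurableSet fun y hy => ?_
                simp only
                rw [lintegral_const_mul' _ _ ENNReal.ofReal_ne_top]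
                gcongr
                exact lintegral_sub_rpow_le hR t hy
            _ = (∫⁻ y, ENNReal.ofReal (F y) ∂ν) * K := lintegral_mul_const' _ _ hK.ne
            _ ≤ _ := by gcongr
        · rw [lintegral_prod _ hD]
          calc _ ≤ ∫⁻ y, ENNReal.ofReal (F y) * K ∂ν := by
                refine setLIntegral_mono' hΩo.measurableSet fun y hy => ?_
                simp only
                rw [lintegral_const_mul' _ _ ENNReal.ofReal_ne_top]
                gcongr
                simp_rw [norm_sub_rev y]
                exact lintegral_sub_rpow_le hR t hy
            _ = (∫⁻ y, ENNReal.ofReal (F y) ∂ν) * K := lintegral_mul_const' _ _ hK.ne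
            _ ≤ _ := by gcongr

/-! ### Limits in the weak formulation -/

lemma tendsto_integral_mul_of_ae_tendsto_of_le_one {X : Type*} [MeasurableSpace X] {ν : Measure X}
    {g : X → ℝ} {f : ℕ → X → ℝ} {f₀ : X → ℝ} (hg : Integrable g ν)
    (hf : ∀ k, AEStronglyMeasurable (f k) ν) (hb : ∀ k x, |f k x| ≤ 1)
    (hlim : ∀ᵐ x ∂ν, Tendsto (fun k => f k x) atTop (𝓝 (f₀ x))) :
    Tendsto (fun k => ∫ x, g x * f k x ∂ν) atTop (𝓝 (∫ x, g x * f₀ x ∂ν)) := by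
  refine tendsto_integral_of_dominated_convergence (fun x => |g x|) (fun k => hg.1.mul (hf k))
    hg.abs (fun k => Eventually.of_forall fun x => ?_) ?_
  · rw [Real.norm_eq_abs, abs_mul]
    exact mul_le_of_le_one_right (abs_nonneg _) (hb k x)
  · filter_upwards [hlim] with x hx
    exact hx.const_mul _

lemma aestronglyMeasurable_diffQuotient {N : ℕ} {v : RN N → ℝ} (hv : AEStronglyMeasurable v volume)
    (e : ℝ) : AEStronglyMeasurable
      (fun z : RN N × RN N => (v z.1 - v z.2) / ‖z.1 - z.2‖ ^ e) volume := by
  have h1 : AEStronglyMeasurable (fun z : RN N × RN N => v z.1) volume :=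
    hv.comp_quasiMeasurePreserving Measure.quasiMeasurePreserving_fst
  have h2 : AEStronglyMeasurable (fun z : RN N × RN N => v z.2) volume :=
    hv.comp_quasiMeasurePreserving Measure.quasiMeasurePreserving_snd
  have h3 : Measurable fun z : RN N × RN N => ‖z.1 - z.2‖ ^ e := by fun_prop
  exact ((h1.sub h2).aemeasurable.div h3.aemeasurable).aestronglyMeasurable

lemma lintegral_sq_diffQuotient {N : ℕ} (s : ℝ) (v : RN N → ℝ) :
    ∫⁻ z : RN N × RN N, ENNReal.ofReal
      (((v z.1 - v z.2) / ‖z.1 - z.2‖ ^ (((N : ℝ) + 2 * s) / 2)) ^ 2) = gagliardo s 2 v := by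
  refine lintegral_congr fun z => ?_
  rw [div_pow, Real.rpow_two, sq_abs, ← Real.rpow_natCast (‖z.1 - z.2‖ ^ _),
    ← Real.rpow_mul (norm_nonneg _)]
  congr 3
  push_cast; ring

lemma memLp_diffQuotient {N : ℕ} {s : ℝ} {v : RN N → ℝ}
    (hv : AEStronglyMeasurable v volume) (hg : gagliardo s 2 v < ⊤) :
    MemLp (fun z : RN N × RN N => (v z.1 - v z.2) / ‖z.1 - z.2‖ ^ (((N : ℝ) + 2 * s) / 2)) 2
      volume := by
  have hm := aestronglyMeasurable_diffQuotient hv (((N : ℝ) + 2 * s) / 2)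
  rw [memLp_two_iff_integrable_sq hm]
  refine ⟨hm.pow 2, ?_⟩
  rw [hasFiniteIntegral_iff_ofReal (Eventually.of_forall fun x => sq_nonneg _),
    lintegral_sq_diffQuotient]
  exact hg

/-- Splitting the kernel evenly exhibits the form as an L² pairing of difference quotients, to which
the weak convergence lemma applies. -/
lemma fracForm_eq {N : ℕ} {s : ℝ} (hs : 0 < s) (u φ : RN N → ℝ) :
    fracForm s u φ = ∫ z : RN N × RN N,
      ((u z.1 - u z.2) / ‖z.1 - z.2‖ ^ (((N : ℝ) + 2 * s) / 2)) *
      ((φ z.1 - φ z.2) / ‖z.1 - z.2‖ ^ (((N : ℝ) + 2 * s) / 2)) := by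
  refine integral_congr_ae (Eventually.of_forall fun z => ?_)
  simp only
  rw [div_mul_div_comm, ← Real.rpow_add_of_nonneg (norm_nonneg _) (by positivity) (by positivity)]
  congr 2
  ring

lemma tendsto_fracForm {N : ℕ} {s : ℝ} (hs : 0 < s) {u : RN N → ℝ}
    (hum : AEStronglyMeasurable u volume) (hug : gagliardo s 2 u < ⊤) {φ : ℕ → RN N → ℝ}
    {φ₀ : RN N → ℝ} {C : ℝ≥0∞} (hC : C ≠ ⊤) (hφ : ∀ k, AEStronglyMeasurable (φ k) volume)
    (hb : ∀ k, gagliardo s 2 (φ k) ≤ C)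
    (hlim : ∀ᵐ x, Tendsto (fun k => φ k x) atTop (𝓝 (φ₀ x))) :
    Tendsto (fun k => fracForm s u (φ k)) atTop (𝓝 (fracForm s u φ₀)) := by
  simp_rw [fracForm_eq hs]
  refine tendsto_integral_mul_of_ae_tendsto_of_sq_bounded hC (memLp_diffQuotient hum hug)
    (fun k => aestronglyMeasurable_diffQuotient (hφ k) _) (fun k => ?_) ?_
  · rw [lintegral_sq_diffQuotient]; exact hb k
  · filter_upwards [ae_prod_fst hlim, ae_prod_snd hlim] with z h1 h2
    exact (h1.sub h2).div_const _

/-- The weak formulation tested with the single function `φ`. -/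
def WeakIdentity {N : ℕ} (Ω : Set (RN N)) (κ s b γ α lam β : ℝ) (n : ℕ) (μn u φ : RN N → ℝ) :
    Prop :=
  κ * fracForm s u φ - α * (∫ x in Ω, u x * φ x / ‖x‖ ^ (2 * s)) =
      lam * (∫ x in Ω, u x * φ x)
      + (∫ x in Ω, φ x / (u x + 1 / (n : ℝ)) ^ γ)
      + β * (∫ z in Ω ×ˢ Ω,
          u z.2 ^ twoStarB N s b * u z.1 ^ (twoStarB N s b - 1) * φ z.1 / ‖z.1 - z.2‖ ^ b)
      + (∫ x in Ω, μn x * φ x)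

/-- The integrability of the coefficients of a bounded test function in the weak formulation. -/
structure IntegrableData {N : ℕ} (Ω : Set (RN N)) (s b γ : ℝ) (n : ℕ) (μn u : RN N → ℝ) :
    Prop where
  hardy : IntegrableOn (fun x => u x / ‖x‖ ^ (2 * s)) Ω
  linear : IntegrableOn u Ω
  singular : IntegrableOn (fun x => 1 / (u x + 1 / (n : ℝ)) ^ γ) Ω
  choquard : IntegrableOn (fun z : RN N × RN N =>
    u z.2 ^ twoStarB N s b * u z.1 ^ (twoStarB N s b - 1) / ‖z.1 - z.2‖ ^ b) (Ω ×ˢ Ω)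
  datum : IntegrableOn μn Ω

/-- Only bounded energies and pointwise limits are needed: the quadratic form passes to the limit
weakly in L², and the other terms by dominated convergence against integrable coefficients. -/
lemma WeakIdentity.of_tendsto {N : ℕ} {Ω : Set (RN N)} {κ s b γ α lam β : ℝ} {n : ℕ}
    {μn u : RN N → ℝ} (hs : 0 < s) (hum : AEStronglyMeasurable u volume)
    (hug : gagliardo s 2 u < ⊤) (hI : IntegrableData Ω s b γ n μn u)
    {φ : ℕ → RN N → ℝ} {φ₀ : RN N → ℝ} {C : ℝ≥0∞} (hC : C ≠ ⊤)
    (hφ : ∀ k, AEStronglyMeasurable (φ k) volume) (hφ1 : ∀ k x, |φ k x| ≤ 1)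
    (hb : ∀ k, gagliardo s 2 (φ k) ≤ C)
    (hlim : ∀ᵐ x, Tendsto (fun k => φ k x) atTop (𝓝 (φ₀ x)))
    (hw : ∀ k, WeakIdentity Ω κ s b γ α lam β n μn u (φ k)) :
    WeakIdentity Ω κ s b γ α lam β n μn u φ₀ := by
  have hlimΩ : ∀ᵐ x ∂(volume.restrict Ω), Tendsto (fun k => φ k x) atTop (𝓝 (φ₀ x)) :=
    ae_restrict_of_ae hlim
  have hφfst : ∀ k, AEStronglyMeasurable (fun z : RN N × RN N => φ k z.1) volume := fun k =>
    (hφ k).comp_quasiMeasurePreserving Measure.quasiMeasurePreserving_fst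
  have h1 := tendsto_fracForm hs hum hug hC hφ hb hlim
  have h2 := tendsto_integral_mul_of_ae_tendsto_of_le_one hI.hardy (fun k => (hφ k).restrict)
    hφ1 hlimΩ
  have h3 := tendsto_integral_mul_of_ae_tendsto_of_le_one hI.linear (fun k => (hφ k).restrict)
    hφ1 hlimΩ
  have h4 := tendsto_integral_mul_of_ae_tendsto_of_le_one hI.singular (fun k => (hφ k).restrict)
    hφ1 hlimΩ
  have h5 := tendsto_integral_mul_of_ae_tendsto_of_le_one hI.choquard
    (fun k => (hφfst k).restrict) (fun k z => hφ1 k z.1) (ae_restrict_of_ae (ae_prod_fst hlim))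
  have h6 := tendsto_integral_mul_of_ae_tendsto_of_le_one hI.datum (fun k => (hφ k).restrict)
    hφ1 hlimΩ
  simp only [div_mul_eq_mul_div, one_mul] at h2 h4 h5
  refine tendsto_nhds_unique (((h1.const_mul κ).sub (h2.const_mul α)).congr fun k => hw k)
    ((((h3.const_mul lam).add h4).add (h5.const_mul β)).add h6)

/-! ### The saturated solution as a test function -/

/-- The bounded increasing function `t ↦ |t| / (1 + |t|)`, which is composed with the solution to
get a test function. -/
noncomputable def saturate (t : ℝ) : ℝ := |t| / (1 + |t|)

lemma saturate_nonneg (t : ℝ) : 0 ≤ saturate t := by unfold saturate; positivity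

lemma saturate_le_one (t : ℝ) : saturate t ≤ 1 := by
  unfold saturate
  rw [div_le_one (by positivity)]
  linarith

lemma abs_saturate_le_one (t : ℝ) : |saturate t| ≤ 1 := by
  rw [abs_of_nonneg (saturate_nonneg t)]; exact saturate_le_one t

lemma saturate_zero : saturate 0 = 0 := by simp [saturate]

lemma measurable_saturate : Measurable saturate := by unfold saturate; fun_prop

lemma saturate_sub (a b : ℝ) :
    saturate a - saturate b = (|a| - |b|) / ((1 + |a|) * (1 + |b|)) := by
  unfold saturate
  have h1 : (0:ℝ) < 1 + |a| := by positivity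
  have h2 : (0:ℝ) < 1 + |b| := by positivity
  field_simp
  ring

lemma abs_saturate_sub_le (a b : ℝ) : |saturate a - saturate b| ≤ |a - b| := by
  rw [saturate_sub, abs_div]
  have h1 := abs_nonneg a
  have h2 := abs_nonneg b
  have h3 : 1 ≤ (1 + |a|) * (1 + |b|) := by nlinarith [mul_nonneg h1 h2]
  calc _ ≤ |(|a| - |b|)| := by
        refine div_le_self (abs_nonneg _) ?_
        rwa [abs_of_nonneg (by positivity)]
    _ ≤ _ := abs_abs_sub_abs_le a b

lemma gagliardo_two_saturate_le {N : ℕ} (s : ℝ) (u : RN N → ℝ) :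
    gagliardo s 2 (fun x => saturate (u x)) ≤ gagliardo s 2 u := by
  refine lintegral_mono fun z => ENNReal.ofReal_le_ofReal ?_
  exact div_le_div_of_nonneg_right (Real.rpow_le_rpow (abs_nonneg _) (abs_saturate_sub_le _ _)
    (by norm_num)) (by positivity)

lemma isCompact_cutoff_set {N : ℕ} {Ω : Set (RN N)}
    (hΩb : Bornology.IsBounded Ω) (k : ℕ) :
    IsCompact {x : RN N | 1 ≤ ((k : ℝ) + 1) * infDist x Ωᶜ} ∧
      {x : RN N | 1 ≤ ((k : ℝ) + 1) * infDist x Ωᶜ} ⊆ Ω := by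
  have hsub : {x : RN N | 1 ≤ ((k : ℝ) + 1) * infDist x Ωᶜ} ⊆ Ω := by
    intro x hx
    by_contra h
    have : infDist x Ωᶜ = 0 := infDist_zero_of_mem h
    rw [mem_ofPred_eq, this] at hx
    linarith
  refine ⟨Metric.isCompact_of_isClosed_isBounded ?_ (hΩb.subset hsub), hsub⟩
  exact isClosed_le continuous_const (continuous_const.mul (continuous_infDist_pt _))

/-- The compact sets where the distance to the complement is at least 1/(k+1) exhaust Ω, and
countably many null sets are discarded. -/
lemma ae_pos_of_locally_pos {N : ℕ} (hN : 1 ≤ N) {Ω : Set (RN N)} (hΩo : IsOpen Ω)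
    (hΩb : Bornology.IsBounded Ω) {u : RN N → ℝ}
    (hu : ∀ K : Set (RN N), IsCompact K → K ⊆ Ω →
      ∃ c : ℝ, 0 < c ∧ ∀ᵐ x ∂(volume.restrict K), c ≤ u x) :
    ∀ᵐ x, x ∈ Ω → 0 < u x := by
  have h : ∀ k : ℕ, ∀ᵐ x, 1 ≤ ((k : ℝ) + 1) * infDist x Ωᶜ → 0 < u x := by
    intro k
    obtain ⟨hc, hsub⟩ := isCompact_cutoff_set hΩb k
    obtain ⟨c, hc0, hcu⟩ := hu _ hc hsub
    rw [ae_restrict_iff' hc.measurableSet] at hcu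
    filter_upwards [hcu] with x hx hx1
    exact hc0.trans_le (hx hx1)
  filter_upwards [ae_all_iff.2 h] with x hx hxΩ
  have hd := infDist_compl_pos hN hΩo hΩb hxΩ
  obtain ⟨k, hk⟩ := exists_nat_gt (1 / infDist x Ωᶜ)
  refine hx k ?_
  rw [div_lt_iff₀ hd] at hk
  nlinarith

/-- Two successive limits: mollification at a fixed cutoff scale k, then k → ∞. Only the second
needs the energy bound uniform in k. -/
lemma WeakIdentity.saturate {N : ℕ} (hN : 1 ≤ N) {Ω : Set (RN N)} {κ s b γ α lam β : ℝ} {n : ℕ}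
    {μn u : RN N → ℝ} (hΩo : IsOpen Ω) (hΩb : Bornology.IsBounded Ω) (hΩr : HasC2Boundary Ω)
    (hs0 : 0 < s) (hs1 : s < 1) (hu : IsWeakSolution Ω κ s b γ α lam β n μn u)
    (hI : IntegrableData Ω s b γ n μn u) :
    WeakIdentity Ω κ s b γ α lam β n μn u (fun x => FracChoquard.saturate (u x)) := by
  have hum := hu.memH.memLp.1
  have hug := hu.memH.gagliardo_lt_top
  -- A measurable representative, since the cutoff and mollification lemmas are stated for
  -- measurable functions.
  set w := hum.mk u with hw
  have hwm : Measurable w := hum.stronglyMeasurable_mk.measurable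
  have hwu : u =ᵐ[volume] w := hum.ae_eq_mk
  set v : RN N → ℝ := fun x => FracChoquard.saturate (w x) with hv
  have hvm : Measurable v := measurable_saturate.comp hwm
  have hvg : gagliardo s 2 v < ⊤ := by
    refine (gagliardo_two_saturate_le s w).trans_lt ?_
    rwa [← gagliardo_congr hwu]
  have hv0 : ∀ᵐ x, x ∉ Ω → v x = 0 := by
    filter_upwards [hwu, hu.memH.zero_outside] with x h1 h2 h3
    rw [hv]
    simp only
    rw [← h1, h2 h3, saturate_zero]
  obtain ⟨C, hC, hCk⟩ := exists_gagliardo_cutoff_le hN hΩo hΩb hΩr hs0 hs1 hvm hv0 hvg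
  set φ : ℕ → RN N → ℝ := fun k x => cutoffProfile ((k : ℝ) + 1) (infDist x Ωᶜ) * v x with hφ
  have hφm : ∀ k, Measurable (φ k) := fun k =>
    ((continuous_cutoffProfile _).comp (continuous_infDist_pt _)).measurable.mul hvm
  have hφ1 : ∀ k x, |φ k x| ≤ 1 := fun k x => by
    simp only [hφ, abs_mul]
    rw [abs_of_nonneg (cutoffProfile_nonneg _ _)]
    exact mul_le_one₀ (cutoffProfile_le_one _ _) (abs_nonneg _) (abs_saturate_le_one _)
  have hφg : ∀ k, gagliardo s 2 (φ k) ≤ C := fun k => hCk _ (by positivity)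
  have hφw : ∀ k, WeakIdentity Ω κ s b γ α lam β n μn u (φ k) := by
    intro k
    obtain ⟨hKc, hKΩ⟩ := isCompact_cutoff_set hΩb k
    obtain ⟨ψ, hψt, hψ1, hψg, hψl⟩ := exists_isTestFunction_tendsto (s := s) hΩo hKc hKΩ (hφm k)
      (hφ1 k) (fun x hx => by
        simp only [hφ]
        rw [cutoffProfile_of_le (not_le.1 hx).le, zero_mul])
    exact WeakIdentity.of_tendsto hs0 hum hug hI ((hφg k).trans_lt hC.lt_top).ne
      (fun j => (hψt j).contDiff.continuous.aestronglyMeasurable) hψ1 hψg hψl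
      (fun j => hu.weak_form _ (hψt j))
  refine WeakIdentity.of_tendsto hs0 hum hug hI hC (fun k => (hφm k).aestronglyMeasurable) hφ1 hφg
    ?_ hφw
  filter_upwards [hwu, hv0] with x h1 h2
  rw [h1]
  by_cases hx : x ∈ Ω
  -- At a point of Ω the cutoff is eventually equal to 1, so the sequence is eventually constant.
  · refine tendsto_const_nhds.congr' ?_
    have hd := infDist_compl_pos hN hΩo hΩb hx
    filter_upwards [eventually_ge_atTop ⌈2 / infDist x Ωᶜ⌉₊] with k hk
    have hk' : 2 / infDist x Ωᶜ ≤ k := (Nat.le_ceil _).trans (by exact_mod_cast hk)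
    simp only [hφ]
    rw [cutoffProfile_of_ge, one_mul]
    rw [div_le_iff₀ hd] at hk'
    nlinarith
  · have := h2 hx
    simp only [hφ, this, mul_zero]
    simp only [hv] at this
    rw [this]
    exact tendsto_const_nhds

/-! ### The weighted energy estimate -/

/-- The energy density obtained by testing with `saturate ∘ u`. -/
noncomputable def energyDensity {N : ℕ} (s : ℝ) (u : RN N → ℝ) (z : RN N × RN N) : ℝ :=
  |u z.1 - u z.2| ^ 2 / ((1 + |u z.1|) * (1 + |u z.2|) * ‖z.1 - z.2‖ ^ ((N : ℝ) + 2 * s))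

lemma energyDensity_nonneg {N : ℕ} (s : ℝ) (u : RN N → ℝ) (z : RN N × RN N) :
    0 ≤ energyDensity s u z := by unfold energyDensity; positivity

lemma aestronglyMeasurable_energyDensity {N : ℕ} (s : ℝ) {u : RN N → ℝ}
    (hum : AEStronglyMeasurable u volume) :
    AEStronglyMeasurable (energyDensity s u) volume := by
  have h1 : AEMeasurable (fun z : RN N × RN N => u z.1) volume :=
    hum.aemeasurable.comp_quasiMeasurePreserving Measure.quasiMeasurePreserving_fst
  have h2 : AEMeasurable (fun z : RN N × RN N => u z.2) volume :=
    hum.aemeasurable.comp_quasiMeasurePreserving Measure.quasiMeasurePreserving_snd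
  have h3 : Measurable fun q : ℝ × ℝ × ℝ =>
      |q.1 - q.2.1| ^ 2 / ((1 + |q.1|) * (1 + |q.2.1|) * q.2.2) := by fun_prop
  have h4 : Measurable fun z : RN N × RN N => ‖z.1 - z.2‖ ^ ((N : ℝ) + 2 * s) := by fun_prop
  exact (h3.comp_aemeasurable (h1.prodMk (h2.prodMk h4.aemeasurable))).aestronglyMeasurable

lemma integrable_energyDensity {N : ℕ} {s : ℝ} {u : RN N → ℝ}
    (hum : AEStronglyMeasurable u volume) (hug : gagliardo s 2 u < ⊤) :
    Integrable (energyDensity s u) := by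
  refine ⟨aestronglyMeasurable_energyDensity s hum, ?_⟩
  rw [hasFiniteIntegral_iff_ofReal (Eventually.of_forall fun z => energyDensity_nonneg s u z)]
  refine lt_of_le_of_lt (lintegral_mono fun z => ENNReal.ofReal_le_ofReal ?_) hug
  rw [energyDensity, Real.rpow_two, mul_comm s 2, ← div_div]
  gcongr
  refine div_le_self (by positivity) ?_
  nlinarith [abs_nonneg (u z.1), abs_nonneg (u z.2), mul_nonneg (abs_nonneg (u z.1))
    (abs_nonneg (u z.2))]

lemma fracForm_saturate {N : ℕ} {s : ℝ} {u : RN N → ℝ} (hu0 : ∀ᵐ x, 0 ≤ u x) :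
    fracForm s u (fun x => saturate (u x)) = ∫ z, energyDensity s u z := by
  refine integral_congr_ae ?_
  filter_upwards [ae_prod_fst hu0, ae_prod_snd hu0] with z h1 h2
  simp only [energyDensity]
  rw [saturate_sub, abs_of_nonneg h1, abs_of_nonneg h2, sq_abs, mul_div_assoc', div_div, sq]

lemma integral_mul_le_toReal {X : Type*} [MeasurableSpace X] {ν : Measure X} {g φ : X → ℝ}
    {C : ℝ≥0∞} (hC : C ≠ ⊤) (hg : ∫⁻ x, ENNReal.ofReal |g x| ∂ν ≤ C) (hφ : ∀ x, |φ x| ≤ 1) :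
    ∫ x, g x * φ x ∂ν ≤ C.toReal := by
  refine (Real.le_norm_self _).trans ((norm_integral_le_lintegral_norm _).trans
    (ENNReal.toReal_mono hC (le_trans (lintegral_mono fun x => ?_) hg)))
  refine ENNReal.ofReal_le_ofReal ?_
  rw [Real.norm_eq_abs, abs_mul]
  exact mul_le_of_le_one_right (abs_nonneg _) (hφ x)

/-- Writing t = t^γ t^{1-γ} gives t ≤ (t+ε)^γ (1+t): the zero of `saturate` at 0 cancels the
singularity, uniformly in ε = 1/n. -/
lemma abs_saturate_div_rpow_le_one {t ε γ : ℝ} (ht : 0 < t) (hε : 0 ≤ ε) (hγ0 : 0 < γ)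
    (hγ1 : γ < 1) : |saturate t / (t + ε) ^ γ| ≤ 1 := by
  have h1 : 0 < (t + ε) ^ γ := by positivity
  have h0 := saturate_nonneg t
  rw [abs_of_nonneg (by positivity), div_le_one h1]
  unfold saturate
  rw [abs_of_pos ht, div_le_iff₀ (by positivity)]
  calc t = t ^ γ * t ^ (1 - γ) := by
        rw [← Real.rpow_add ht, add_sub_cancel, Real.rpow_one]
    _ ≤ (t + ε) ^ γ * (1 + t) := by
        gcongr
        · linarith
        · simpa using rpow_le_one_add_rpow ht.le (by linarith : 0 ≤ 1 - γ) (by linarith : 1 - γ ≤ 1)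

/-- Qualitative, for one fixed n: the singular coefficient is bounded by n^γ, and the datum is
integrable because it is bounded on a set of finite measure. Uniformity in n is obtained only after
testing. -/
lemma integrableData_of_isWeakSolution {N : ℕ} {Ω : Set (RN N)} (hΩo : IsOpen Ω)
    (hΩb : Bornology.IsBounded Ω) {κ s b γ α lam β : ℝ} (hs0 : 0 < s)
    (hN : 2 * s < N) (hb0 : 0 < b) (hbN : b < min (N : ℝ) (4 * s)) (hγ0 : 0 < γ)
    {n : ℕ} (hn : 1 ≤ n) {μn u : RN N → ℝ} (hμ : MemLp μn ⊤ (volume.restrict Ω))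
    (hu : IsWeakSolution Ω κ s b γ α lam β n μn u) (hu0 : ∀ᵐ x, 0 ≤ u x)
    (hu1 : ∫⁻ x in Ω, ENNReal.ofReal (|u x| ^ twoStar N s) ≤ 1) :
    IntegrableData Ω s b γ n μn u := by
  have hum := hu.memH.memLp.1
  have hfin : IsFiniteMeasure ((volume : Measure (RN N)).restrict Ω) :=
    ⟨by rw [Measure.restrict_apply_univ]; exact hΩb.measure_lt_top⟩
  obtain ⟨C₁, hC₁, h₁⟩ := exists_lintegral_hardy_le hΩb hs0 hN
  obtain ⟨C₂, hC₂, h₂⟩ := exists_lintegral_choquard_le hΩo hΩb hs0 hN hb0 hbN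
  have hn0 : (0:ℝ) < 1 / n := by
    have : (0:ℝ) < n := by exact_mod_cast hn
    positivity
  refine ⟨⟨?_, ?_⟩, ?_, ?_, ⟨?_, ?_⟩, ?_⟩
  · exact (hum.aemeasurable.restrict.div (by fun_prop)).aestronglyMeasurable
  · rw [hasFiniteIntegral_iff_norm]
    refine lt_of_le_of_lt (le_trans (lintegral_mono fun x => ENNReal.ofReal_le_ofReal ?_)
      (h₁ u hu1)) hC₁.lt_top
    rw [Real.norm_eq_abs, abs_div, abs_of_nonneg (show 0 ≤ ‖x‖ ^ (2 * s) by positivity)]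
  · exact ((hu.memH.memLp.restrict Ω).integrable (by simp))
  · refine Integrable.mono' (g := fun _ => 1 / (1 / (n : ℝ)) ^ γ) (integrable_const _) ?_ ?_
    · exact (((hum.aemeasurable.restrict.add_const _).pow_const γ).const_div 1).aestronglyMeasurable
    · filter_upwards [ae_restrict_of_ae hu0] with x hx
      rw [Real.norm_of_nonneg (by positivity)]
      gcongr
      linarith
  · have h1 : AEMeasurable (fun z : RN N × RN N => u z.1) volume :=
      hum.aemeasurable.comp_quasiMeasurePreserving Measure.quasiMeasurePreserving_fst
    have h2 : AEMeasurable (fun z : RN N × RN N => u z.2) volume :=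
      hum.aemeasurable.comp_quasiMeasurePreserving Measure.quasiMeasurePreserving_snd
    exact (((h2.pow_const _).mul (h1.pow_const _)).div
      (show Measurable fun z : RN N × RN N => ‖z.1 - z.2‖ ^ b by fun_prop).aemeasurable
      ).restrict.aestronglyMeasurable
  · rw [hasFiniteIntegral_iff_norm]
    refine lt_of_le_of_lt (le_trans (lintegral_mono_ae ?_) (h₂ u hum hu1)) hC₂.lt_top
    filter_upwards [ae_restrict_of_ae (ae_prod_fst hu0), ae_restrict_of_ae (ae_prod_snd hu0)]
      with z h1 h2
    rw [abs_of_nonneg h1, abs_of_nonneg h2, Real.norm_of_nonneg (by positivity)]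
  · exact hμ.integrable (by simp)

/-- Weak solutions in the unit ball of `L^{2_s^*}` have uniformly bounded energy. -/
lemma exists_lintegral_energyDensity_le {N : ℕ} {Ω : Set (RN N)} (hΩo : IsOpen Ω)
    (hΩb : Bornology.IsBounded Ω) (hΩr : HasC2Boundary Ω) {κ s b γ α lam β : ℝ} (hκ : 0 < κ)
    (hs0 : 0 < s) (hs1 : s < 1) (hN : 2 * s < N) (hb0 : 0 < b) (hbN : b < min (N : ℝ) (4 * s))
    (hγ0 : 0 < γ) (hγ1 : γ < 1) (hα : 0 < α) (hlam : 0 < lam) (hβ : 0 < β) (M : ℝ) :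
    ∃ A : ℝ, ∀ (n : ℕ) (μn u : RN N → ℝ), 1 ≤ n → MemLp μn ⊤ (volume.restrict Ω) →
      eLpNorm μn 1 (volume.restrict Ω) ≤ ENNReal.ofReal M →
      IsWeakSolution Ω κ s b γ α lam β n μn u → (∀ᵐ x, x ∈ Ω → 0 < u x) →
      ∫⁻ x in Ω, ENNReal.ofReal (|u x| ^ twoStar N s) ≤ 1 →
      ∫⁻ z, ENNReal.ofReal (energyDensity s u z) ≤ ENNReal.ofReal A := by
  have hN1 : 1 ≤ N := by
    have : (0:ℝ) < N := by linarith
    exact_mod_cast this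
  have hNs : (0:ℝ) < N - 2 * s := by linarith
  obtain ⟨C₁, hC₁, h₁⟩ := exists_lintegral_hardy_le hΩb hs0 hN
  obtain ⟨C₂, hC₂, h₂⟩ := exists_lintegral_choquard_le hΩo hΩb hs0 hN hb0 hbN
  have hV : volume Ω + 1 ≠ ⊤ := ENNReal.add_ne_top.2 ⟨hΩb.measure_lt_top.ne, by simp⟩
  refine ⟨(α * C₁.toReal + lam * (volume Ω + 1).toReal + volume.real Ω + β * C₂.toReal +
    (ENNReal.ofReal M).toReal) / κ, ?_⟩
  intro n μn u hn hμ hμ1 hu hpos hu1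
  have hum := hu.memH.memLp.1
  have hug := hu.memH.gagliardo_lt_top
  have hu0 : ∀ᵐ x, 0 ≤ u x := by
    filter_upwards [hpos, hu.memH.zero_outside] with x h1 h2
    by_cases hx : x ∈ Ω
    · exact (h1 hx).le
    · rw [h2 hx]
  have hI := integrableData_of_isWeakSolution hΩo hΩb hs0 hN hb0 hbN hγ0 hn hμ hu hu0 hu1
  have hw := WeakIdentity.saturate hN1 hΩo hΩb hΩr hs0 hs1 hu hI
  rw [WeakIdentity, fracForm_saturate hu0] at hw
  rw [← ofReal_integral_eq_lintegral_ofReal (integrable_energyDensity hum hug)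
    (Eventually.of_forall fun z => energyDensity_nonneg s u z)]
  refine ENNReal.ofReal_le_ofReal ?_
  rw [le_div_iff₀' hκ]
  have e1 : ∫ x in Ω, u x * saturate (u x) / ‖x‖ ^ (2 * s) ≤ C₁.toReal := by
    simp_rw [← div_mul_eq_mul_div]
    refine integral_mul_le_toReal hC₁ ?_ (fun x => abs_saturate_le_one _)
    refine le_trans (lintegral_mono fun x => ENNReal.ofReal_le_ofReal ?_) (h₁ u hu1)
    rw [abs_div, abs_of_nonneg (show 0 ≤ ‖x‖ ^ (2 * s) by positivity)]
  have e2 : ∫ x in Ω, u x * saturate (u x) ≤ (volume Ω + 1).toReal := by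
    refine integral_mul_le_toReal hV ?_ (fun x => abs_saturate_le_one _)
    have hr : 1 ≤ twoStar N s := by
      rw [twoStar, one_le_div hNs]; linarith
    simpa using lintegral_rpow_le zero_le_one hr hu1
  have e3 : ∫ x in Ω, saturate (u x) / (u x + 1 / (n : ℝ)) ^ γ ≤ volume.real Ω := by
    refine (Real.le_norm_self _).trans ?_
    have := norm_setIntegral_le_of_norm_le_const_ae' (C := 1)
      (hΩb.measure_lt_top (μ := volume))
      (f := fun x => saturate (u x) / (u x + 1 / (n : ℝ)) ^ γ) ?_
    · simpa using this
    · filter_upwards [hpos] with x hx hxΩ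
      exact abs_saturate_div_rpow_le_one (hx hxΩ) (by positivity) hγ0 hγ1
  have e4 : ∫ z in Ω ×ˢ Ω, u z.2 ^ twoStarB N s b * u z.1 ^ (twoStarB N s b - 1) *
      saturate (u z.1) / ‖z.1 - z.2‖ ^ b ≤ C₂.toReal := by
    simp_rw [← div_mul_eq_mul_div]
    refine integral_mul_le_toReal hC₂ ?_ (fun z => abs_saturate_le_one _)
    refine le_trans (lintegral_mono_ae ?_) (h₂ u hum hu1)
    filter_upwards [ae_restrict_of_ae (ae_prod_fst hu0), ae_restrict_of_ae (ae_prod_snd hu0)]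
      with z h1 h2
    rw [abs_of_nonneg h1, abs_of_nonneg h2, abs_of_nonneg (by positivity), div_mul_eq_mul_div]
  have e5 : ∫ x in Ω, μn x * saturate (u x) ≤ (ENNReal.ofReal M).toReal := by
    refine integral_mul_le_toReal ENNReal.ofReal_ne_top ?_ (fun x => abs_saturate_le_one _)
    rw [eLpNorm_one_eq_lintegral_enorm] at hμ1
    refine le_trans (le_of_eq (lintegral_congr fun x => ?_)) hμ1
    rw [← Real.norm_eq_abs, ofReal_norm]
  have e1' := mul_le_mul_of_nonneg_left e1 hα.le
  have e2' := mul_le_mul_of_nonneg_left e2 hlam.le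
  have e4' := mul_le_mul_of_nonneg_left e4 hβ.le
  linarith

/-! ### From the weighted energy to lower-order Gagliardo energies -/

/-- The left side is exactly X^{m/2} Y^{1-m/2} for the two summands X and Y on the right, so
weighted AM-GM applies. For σ < s the power of h in Y is weaker than h^{-d}, hence integrable near
the origin in dimension d. -/
lemma quotient_rpow_le_energy_add {s σ m d D h a : ℝ} (hm1 : 1 ≤ m) (hm2 : m < 2) (ha : 0 ≤ a)
    (hD : 0 < D) (hh : 0 < h) :
    a ^ m / h ^ (d + σ * m) ≤ a ^ 2 / (D * h ^ (d + 2 * s)) +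
      D ^ (m / (2 - m)) * h ^ (-(d - 2 * (s - σ) * m / (2 - m))) := by
  have h2m : 0 < 2 - m := by linarith
  set X := a ^ 2 / (D * h ^ (d + 2 * s)) with hX
  set Y := D ^ (m / (2 - m)) * h ^ (-(d - 2 * (s - σ) * m / (2 - m))) with hY
  have hX0 : 0 ≤ X := by positivity
  have hY0 : 0 ≤ Y := by positivity
  have key := Real.geom_mean_le_arith_mean2_weighted (w₁ := m / 2) (w₂ := 1 - m / 2) (by linarith)
    (by linarith) hX0 hY0 (by ring)
  have h1 : m / 2 * X ≤ X := mul_le_of_le_one_left hX0 (by linarith)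
  have h2 : (1 - m / 2) * Y ≤ Y := mul_le_of_le_one_left hY0 (by linarith)
  refine le_trans (le_of_eq ?_) (key.trans (add_le_add h1 h2))
  rw [hX, hY, Real.div_rpow (by positivity) (by positivity),
    Real.mul_rpow hD.le (by positivity), Real.mul_rpow (by positivity) (by positivity),
    ← Real.rpow_mul hh.le, ← Real.rpow_mul hD.le, ← Real.rpow_mul hh.le, ← Real.rpow_natCast a 2,
    ← Real.rpow_mul ha]
  have e1 : ((2 : ℕ) : ℝ) * (m / 2) = m := by push_cast; ring
  have e2 : m / (2 - m) * (1 - m / 2) = m / 2 := by field_simp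
  have e3 : h ^ (d + σ * m) = h ^ ((d + 2 * s) * (m / 2)) *
      (h ^ (-(d - 2 * (s - σ) * m / (2 - m)) * (1 - m / 2)))⁻¹ := by
    rw [← Real.rpow_neg hh.le, ← Real.rpow_add hh]
    congr 1
    field_simp
    ring
  rw [e1, e2, e3]
  have p1 : 0 < D ^ (m / 2) := by positivity
  have p2 : 0 < h ^ ((d + 2 * s) * (m / 2)) := by positivity
  have p3 : 0 < h ^ (-(d - 2 * (s - σ) * m / (2 - m)) * (1 - m / 2)) := by positivity
  field_simp

lemma one_add_rpow_le {a q r : ℝ} (ha : 0 ≤ a) (hq : 0 ≤ q) (hqr : q ≤ r) :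
    (1 + a) ^ q ≤ 2 ^ q * (1 + a ^ r) := by
  calc (1 + a) ^ q ≤ (2 * max 1 a) ^ q := by
        gcongr
        linarith [le_max_left 1 a, le_max_right 1 a]
    _ = 2 ^ q * (max 1 a) ^ q := Real.mul_rpow (by norm_num) (by positivity)
    _ ≤ 2 ^ q * (1 + a ^ r) := by
        gcongr
        rcases le_total a 1 with h | h
        · rw [max_eq_left h, Real.one_rpow]
          linarith [Real.rpow_nonneg ha r]
        · rw [max_eq_right h]
          exact rpow_le_one_add_rpow ha hq hqr

lemma mul_rpow_half_le {x y q : ℝ} (hx : 0 ≤ x) (hy : 0 ≤ y) (hq : 0 ≤ q) :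
    (x * y) ^ (q / 2) ≤ x ^ q + y ^ q := by
  have hmax : x * y ≤ max x y ^ 2 := by
    rw [sq]; gcongr
    · exact le_max_left _ _
    · exact le_max_right _ _
  calc (x * y) ^ (q / 2) ≤ (max x y ^ 2) ^ (q / 2) := by gcongr
    _ = max x y ^ q := by
        rw [← Real.rpow_natCast, ← Real.rpow_mul (by positivity)]
        congr 1; push_cast; ring
    _ ≤ _ := by
        have := Real.rpow_nonneg hx q
        have := Real.rpow_nonneg hy q
        rcases max_choice x y with h | h <;> rw [h] <;> linarith

lemma abs_sub_rpow_le {x y m q : ℝ} (hm : 0 ≤ m) (hmq : m ≤ q) :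
    |x - y| ^ m ≤ 2 ^ m * ((1 + |x|) ^ q + (1 + |y|) ^ q) := by
  have hx := abs_nonneg x
  have hy := abs_nonneg y
  calc |x - y| ^ m ≤ (2 * max (1 + |x|) (1 + |y|)) ^ m := by
        gcongr
        refine (abs_sub x y).trans ?_
        linarith [le_max_left (1 + |x|) (1 + |y|), le_max_right (1 + |x|) (1 + |y|)]
    _ = 2 ^ m * max (1 + |x|) (1 + |y|) ^ m := Real.mul_rpow (by norm_num) (by positivity)
    _ ≤ 2 ^ m * max (1 + |x|) (1 + |y|) ^ q := by
        gcongr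
        exact le_max_of_le_left (by linarith)
    _ ≤ _ := by
        gcongr
        have := Real.rpow_nonneg (show 0 ≤ 1 + |x| by positivity) q
        have := Real.rpow_nonneg (show 0 ≤ 1 + |y| by positivity) q
        rcases max_choice (1 + |x|) (1 + |y|) with h | h <;> rw [h] <;> linarith

/-- A majorant of `|h|^{-N - σ m}`, improved to the integrable `|h|^{-t}` near the origin. -/
noncomputable def splitKernel {N : ℕ} (t τ : ℝ) (h : RN N) : ℝ≥0∞ :=
  (ball (0 : RN N) 1).indicator (fun h => ENNReal.ofReal (‖h‖ ^ (-t))) h +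
    (ball (0 : RN N) 1)ᶜ.indicator (fun h => ENNReal.ofReal (‖h‖ ^ (-τ))) h

lemma measurable_splitKernel {N : ℕ} (t τ : ℝ) : Measurable (splitKernel (N := N) t τ) := by
  refine Measurable.add ?_ ?_
  · exact Measurable.indicator (by fun_prop) measurableSet_ball
  · exact Measurable.indicator (by fun_prop) measurableSet_ball.compl

lemma lintegral_splitKernel_lt_top {N : ℕ} (hN : 1 ≤ N) {t τ : ℝ} (ht : t < N) (hτ : (N : ℝ) < τ) :
    ∫⁻ h : RN N, splitKernel t τ h < ⊤ := by
  unfold splitKernel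
  rw [lintegral_add_left (Measurable.indicator (by fun_prop) measurableSet_ball),
    lintegral_indicator measurableSet_ball, lintegral_indicator measurableSet_ball.compl]
  exact ENNReal.add_lt_top.2 ⟨lintegral_ball_norm_rpow_lt_top hN ht 1,
    lintegral_compl_ball_norm_rpow_lt_top hN hτ⟩

/-- Young's inequality is used only for |x-y| < 1, where the gain in the kernel matters. Farther
away the original kernel is integrable and the triangle inequality suffices. -/
lemma quotient_le_energy_add_splitKernel {N : ℕ} {s σ m : ℝ} (hm1 : 1 ≤ m) (hm2 : m < 2)
    (u : RN N → ℝ) (z : RN N × RN N) :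
    ENNReal.ofReal (|u z.1 - u z.2| ^ m / ‖z.1 - z.2‖ ^ ((N : ℝ) + σ * m)) ≤
      ENNReal.ofReal (energyDensity s u z) +
      ENNReal.ofReal (2 ^ m * ((1 + |u z.1|) ^ (2 * m / (2 - m)) +
        (1 + |u z.2|) ^ (2 * m / (2 - m)))) *
        splitKernel ((N : ℝ) - 2 * (s - σ) * m / (2 - m)) (N + σ * m) (z.1 - z.2) := by
  have h2m : 0 < 2 - m := by linarith
  have hE := energyDensity_nonneg s u z
  have hx1 : 0 < 1 + |u z.1| := by positivity
  have hy1 : 0 < 1 + |u z.2| := by positivity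
  set q := 2 * m / (2 - m) with hq
  have hq0 : 0 ≤ q := by positivity
  have hmq : m ≤ q := by
    rw [hq, le_div_iff₀ h2m]; nlinarith
  have h2 : (1:ℝ) ≤ 2 ^ m := Real.one_le_rpow (by norm_num) (by linarith)
  rcases (norm_nonneg (z.1 - z.2)).eq_or_lt with h0 | h0
  -- On the diagonal the numerator vanishes because m ≠ 0.
  · have : z.1 = z.2 := by rw [← sub_eq_zero, ← norm_eq_zero, ← h0]
    rw [this]
    simp [Real.zero_rpow (by linarith : m ≠ 0)]
  unfold splitKernel
  by_cases hb : z.1 - z.2 ∈ ball (0 : RN N) 1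
  · rw [indicator_of_mem hb, indicator_of_notMem (by simpa using hb), add_zero,
      ← ENNReal.ofReal_mul (by positivity), ← ENNReal.ofReal_add hE (by positivity)]
    refine ENNReal.ofReal_le_ofReal ((quotient_rpow_le_energy_add (s := s) hm1 hm2 (abs_nonneg _)
      (mul_pos hx1 hy1) h0).trans ?_)
    rw [energyDensity]
    gcongr
    rw [show m / (2 - m) = q / 2 by rw [hq]; ring]
    refine (mul_rpow_half_le hx1.le hy1.le hq0).trans ?_
    exact le_mul_of_one_le_left (by positivity) h2
  · rw [indicator_of_notMem hb, indicator_of_mem (by simpa using hb), zero_add,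
      ← ENNReal.ofReal_mul (by positivity)]
    refine le_add_left (ENNReal.ofReal_le_ofReal ?_)
    rw [div_eq_mul_inv, ← Real.rpow_neg h0.le]
    gcongr
    exact abs_sub_rpow_le (by linarith) hmq

/-- The energy bound together with the `L^r` bound controls the Gagliardo energy of lower order. -/
lemma exists_gagliardo_le {N : ℕ} (hN : 1 ≤ N) {Ω : Set (RN N)} (hΩo : IsOpen Ω)
    (hΩb : Bornology.IsBounded Ω) {s σ m r : ℝ} (hσ0 : 0 < σ) (hσs : σ < s) (hm1 : 1 ≤ m)
    (hm2 : m < 2) (hmr : 2 * m / (2 - m) ≤ r) {A : ℝ≥0∞} (hA : A ≠ ⊤) :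
    ∃ C : ℝ≥0∞, C ≠ ⊤ ∧ ∀ u : RN N → ℝ, AEStronglyMeasurable u volume →
      (∀ᵐ x, x ∉ Ω → u x = 0) → ∫⁻ x in Ω, ENNReal.ofReal (|u x| ^ r) ≤ 1 →
      ∫⁻ z, ENNReal.ofReal (energyDensity s u z) ≤ A → gagliardo σ m u ≤ C := by
  have h2m : 0 < 2 - m := by linarith
  set q := 2 * m / (2 - m) with hq
  have hq0 : 0 ≤ q := by positivity
  set t := (N : ℝ) - 2 * (s - σ) * m / (2 - m) with ht
  set τ := (N : ℝ) + σ * m with hτ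
  have htN : t < N := by
    have : 0 < 2 * (s - σ) * m / (2 - m) := by
      have : 0 < s - σ := by linarith
      positivity
    linarith
  have hτN : (N : ℝ) < τ := by
    have : 0 < σ * m := by positivity
    linarith
  have hK := lintegral_splitKernel_lt_top hN htN hτN
  set K := ∫⁻ h : RN N, splitKernel t τ h with hKd
  -- The second factor 2 absorbs the summand 1 contributed by a point outside Ω, where u = 0 and Q
  -- gives nothing.
  set B : ℝ≥0∞ := ENNReal.ofReal (2 ^ m * (2 * 2 ^ q)) with hB
  have hV : volume Ω + 1 ≠ ⊤ := ENNReal.add_ne_top.2 ⟨hΩb.measure_lt_top.ne, by simp⟩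
  refine ⟨A + B * ((volume Ω + 1) * K + (volume Ω + 1) * K), ?_, ?_⟩
  · have := ENNReal.mul_ne_top hV hK.ne
    exact ENNReal.add_ne_top.2 ⟨hA, ENNReal.mul_ne_top ENNReal.ofReal_ne_top
      (ENNReal.add_ne_top.2 ⟨this, this⟩)⟩
  intro u hum hu0 hur hE
  set Q : RN N → ℝ≥0∞ := Ω.indicator fun x => ENNReal.ofReal (1 + |u x| ^ r) with hQ
  have hQm : AEMeasurable Q volume :=
    (((measurable_abs.comp_aemeasurable hum.aemeasurable).pow_const r).const_add 1
      |>.ennreal_ofReal).indicator hΩo.measurableSet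
  have hQi : ∫⁻ x, Q x ≤ volume Ω + 1 := by
    rw [hQ, lintegral_indicator hΩo.measurableSet]
    exact lintegral_one_add_le (fun x => Real.rpow_nonneg (abs_nonneg (u x)) r) hur
  have hkm : Measurable fun z : RN N × RN N => splitKernel t τ (z.1 - z.2) :=
    (measurable_splitKernel t τ).comp (by fun_prop)
  have hk1 : ∀ x : RN N, Measurable fun y => splitKernel t τ (x - y) := fun x =>
    (measurable_splitKernel t τ).comp (by fun_prop)
  have hk2 : ∀ y : RN N, Measurable fun x => splitKernel t τ (x - y) := fun y =>
    (measurable_splitKernel t τ).comp (by fun_prop)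
  have hQ1 : AEMeasurable (fun z : RN N × RN N => Q z.1 * splitKernel t τ (z.1 - z.2))
      (volume.prod volume) :=
    (hQm.comp_quasiMeasurePreserving Measure.quasiMeasurePreserving_fst).mul hkm.aemeasurable
  have hQ2 : AEMeasurable (fun z : RN N × RN N => Q z.2 * splitKernel t τ (z.1 - z.2))
      (volume.prod volume) :=
    (hQm.comp_quasiMeasurePreserving Measure.quasiMeasurePreserving_snd).mul hkm.aemeasurable
  have hpt : ∀ᵐ z : RN N × RN N,
      ENNReal.ofReal (|u z.1 - u z.2| ^ m / ‖z.1 - z.2‖ ^ ((N : ℝ) + σ * m)) ≤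
      ENNReal.ofReal (energyDensity s u z) +
        B * (Q z.1 * splitKernel t τ (z.1 - z.2) + Q z.2 * splitKernel t τ (z.1 - z.2)) := by
    filter_upwards [ae_prod_fst hu0, ae_prod_snd hu0] with z h1 h2
    -- If both points lie outside Ω the quotient is 0; otherwise at least one value of Q is at least
    -- 1.
    by_cases hz : z.1 ∈ Ω ∨ z.2 ∈ Ω
    · refine (quotient_le_energy_add_splitKernel (s := s) hm1 hm2 u z).trans ?_
      rw [← add_mul, ← mul_assoc]
      gcongr
      have hfx := one_add_rpow_le (abs_nonneg (u z.1)) hq0 hmr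
      have hfy := one_add_rpow_le (abs_nonneg (u z.2)) hq0 hmr
      have p2 : (1:ℝ) ≤ 2 ^ q := Real.one_le_rpow (by norm_num) hq0
      have p3 : (0:ℝ) < 2 ^ m := by positivity
      have hx := Real.rpow_nonneg (abs_nonneg (u z.1)) r
      have hy := Real.rpow_nonneg (abs_nonneg (u z.2)) r
      have hx' : 0 ≤ 2 ^ q * |u z.1| ^ r := by positivity
      have hy' : 0 ≤ 2 ^ q * |u z.2| ^ r := by positivity
      by_cases hzx : z.1 ∈ Ω
      · by_cases hzy : z.2 ∈ Ω
        · rw [hQ, indicator_of_mem hzx, indicator_of_mem hzy,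
            ← ENNReal.ofReal_add (by positivity) (by positivity),
            ← ENNReal.ofReal_mul (by positivity)]
          refine ENNReal.ofReal_le_ofReal ?_
          rw [mul_assoc]
          gcongr
          nlinarith
        · rw [hQ, indicator_of_mem hzx, indicator_of_notMem hzy, add_zero,
            ← ENNReal.ofReal_mul (by positivity), h2 hzy]
          refine ENNReal.ofReal_le_ofReal ?_
          rw [mul_assoc, abs_zero, add_zero, Real.one_rpow]
          gcongr
          nlinarith
      · have hzy : z.2 ∈ Ω := hz.resolve_left hzx
        rw [hQ, indicator_of_notMem hzx, indicator_of_mem hzy, zero_add,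
            ← ENNReal.ofReal_mul (by positivity), h1 hzx]
        refine ENNReal.ofReal_le_ofReal ?_
        rw [mul_assoc, abs_zero, add_zero, Real.one_rpow]
        gcongr
        nlinarith
    · push Not at hz
      rw [h1 hz.1, h2 hz.2]
      simp [Real.zero_rpow (by linarith : m ≠ 0)]
  have hi1 : ∫⁻ z : RN N × RN N, Q z.1 * splitKernel t τ (z.1 - z.2) ≤ (volume Ω + 1) * K := by
    rw [Measure.volume_eq_prod, lintegral_prod _ hQ1]
    calc _ = ∫⁻ x, Q x * K := by
          refine lintegral_congr fun x => ?_
          simp only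
          rw [lintegral_const_mul _ (hk1 x),
            lintegral_sub_left_eq_self (fun h : RN N => splitKernel t τ h) x]
      _ = (∫⁻ x, Q x) * K := lintegral_mul_const' _ _ hK.ne
      _ ≤ _ := by gcongr
  have hi2 : ∫⁻ z : RN N × RN N, Q z.2 * splitKernel t τ (z.1 - z.2) ≤ (volume Ω + 1) * K := by
    rw [Measure.volume_eq_prod, lintegral_prod_symm _ hQ2]
    calc _ = ∫⁻ x, Q x * K := by
          refine lintegral_congr fun x => ?_
          simp only
          rw [lintegral_const_mul _ (hk2 x),
            lintegral_sub_right_eq_self (fun h : RN N => splitKernel t τ h) x]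
      _ = (∫⁻ x, Q x) * K := lintegral_mul_const' _ _ hK.ne
      _ ≤ _ := by gcongr
  calc gagliardo σ m u ≤ ∫⁻ z : RN N × RN N, (ENNReal.ofReal (energyDensity s u z) +
        B * (Q z.1 * splitKernel t τ (z.1 - z.2) + Q z.2 * splitKernel t τ (z.1 - z.2))) :=
        lintegral_mono_ae hpt
    _ = (∫⁻ z, ENNReal.ofReal (energyDensity s u z)) +
        B * ((∫⁻ z : RN N × RN N, Q z.1 * splitKernel t τ (z.1 - z.2)) +
          ∫⁻ z : RN N × RN N, Q z.2 * splitKernel t τ (z.1 - z.2)) := by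
        rw [lintegral_add_left'
          (aestronglyMeasurable_energyDensity s hum).aemeasurable.ennreal_ofReal,
          lintegral_const_mul' _ _ ENNReal.ofReal_ne_top, lintegral_add_left' (μ := volume) hQ1]
    _ ≤ _ := by gcongr

/-! ### Norm conversions and conclusion -/

lemma lintegral_rpow_eq_one_of_eLpNorm {N : ℕ} {Ω : Set (RN N)} {u : RN N → ℝ} {r : ℝ} (hr : 0 < r)
    (h : eLpNorm u (ENNReal.ofReal r) (volume.restrict Ω) = 1) :
    ∫⁻ x in Ω, ENNReal.ofReal (|u x| ^ r) = 1 := by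
  rw [eLpNorm_eq_lintegral_rpow_enorm_toReal (by simpa using hr) ENNReal.ofReal_ne_top,
    ENNReal.toReal_ofReal hr.le] at h
  have h' : ∫⁻ x in Ω, ‖u x‖ₑ ^ r = 1 := by
    rw [← ENNReal.rpow_one (∫⁻ x in Ω, ‖u x‖ₑ ^ r), ← one_div_mul_cancel hr.ne', ENNReal.rpow_mul,
      h, ENNReal.one_rpow]
  rw [← h']
  refine lintegral_congr fun x => ?_
  rw [← ENNReal.ofReal_rpow_of_nonneg (abs_nonneg _) hr.le, ← Real.norm_eq_abs, ofReal_norm]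

lemma memLp_of_memLp_two_of_zero_outside {N : ℕ} {Ω : Set (RN N)} (hΩb : Bornology.IsBounded Ω)
    (hΩo : IsOpen Ω) {u : RN N → ℝ} {m : ℝ} (hm : m ≤ 2) (hu : MemLp u (ENNReal.ofReal 2) volume)
    (hu0 : ∀ᵐ x, x ∉ Ω → u x = 0) : MemLp u (ENNReal.ofReal m) volume := by
  have hfin : IsFiniteMeasure ((volume : Measure (RN N)).restrict Ω) :=
    ⟨by rw [Measure.restrict_apply_univ]; exact hΩb.measure_lt_top⟩
  have h1 : MemLp u (ENNReal.ofReal m) (volume.restrict Ω) :=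
    (hu.restrict Ω).mono_exponent (ENNReal.ofReal_le_ofReal hm)
  rw [← memLp_indicator_iff_restrict hΩo.measurableSet] at h1
  refine (memLp_congr_ae ?_).1 h1
  filter_upwards [hu0] with x hx
  by_cases h : x ∈ Ω
  · rw [indicator_of_mem h]
  · rw [indicator_of_notMem h, hx h]

end FracChoquard

theorem mainTheorem3 {N : ℕ} (Ω : Set (FracChoquard.RN N))
    (hΩo : IsOpen Ω) (hΩc : IsConnected Ω) (hΩb : Bornology.IsBounded Ω)
    (hΩr : FracChoquard.HasC2Boundary Ω)
    (κ s b γ α lam β : ℝ) (hκ : 0 < κ)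
    (hs0 : 0 < s) (hs1 : s < 1) (hN : 2 * s < N)
    (hb0 : 0 < b) (hbN : b < min (N : ℝ) (4 * s))
    (hγ0 : 0 < γ) (hγ1 : γ < 1) (hα : 0 < α) (hlam : 0 < lam) (hβ : 0 < β)
    (μ : ℕ → FracChoquard.RN N → ℝ)
    (hμ : ∀ n, 1 ≤ n → MemLp (μ n) ⊤ (volume.restrict Ω))
    (hμ1 : ∃ M : ℝ, ∀ n, 1 ≤ n → eLpNorm (μ n) 1 (volume.restrict Ω) ≤ ENNReal.ofReal M)
    (u : ℕ → FracChoquard.RN N → ℝ)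
    (hu : ∀ n, 1 ≤ n → FracChoquard.IsWeakSolution Ω κ s b γ α lam β n (μ n) (u n))
    (hu1 : ∀ n, 1 ≤ n → eLpNorm (u n) (ENNReal.ofReal (FracChoquard.twoStar N s))
      (volume.restrict Ω) = 1) :
    ∀ σ m : ℝ, 0 < σ → σ < s → 1 ≤ m → m < N / (N - s) →
      ∃ C : ℝ, ∀ n, 1 ≤ n →
        FracChoquard.MemW0 Ω σ m (u n) ∧
          FracChoquard.normW0 σ m (u n) ≤ ENNReal.ofReal C := by
  intro σ m hσ0 hσs hm1 hmN
  obtain ⟨M, hM⟩ := hμ1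
  have hN0 : (0:ℝ) < N := by linarith
  have hN1 : 1 ≤ N := by exact_mod_cast hN0
  have hNs : (0:ℝ) < N - 2 * s := by linarith
  rw [lt_div_iff₀ (by linarith)] at hmN
  -- If m ≥ 2, then 2(N-s) ≤ m(N-s) < N, contradicting N > 2s.
  have hm2 : m < 2 := by
    by_contra! h
    nlinarith
  have hr0 : 0 < FracChoquard.twoStar N s := by unfold FracChoquard.twoStar; positivity
  have hmr : 2 * m / (2 - m) ≤ FracChoquard.twoStar N s := by
    -- Cross-multiplied, the inequality reads m(N-s) ≤ N; this is the origin of the threshold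
    -- N/(N-s).
    rw [FracChoquard.twoStar, div_le_div_iff₀ (by linarith) hNs]
    nlinarith
  obtain ⟨A, hA⟩ := FracChoquard.exists_lintegral_energyDensity_le hΩo hΩb hΩr hκ
    hs0 hs1 hN hb0 hbN hγ0 hγ1
    hα hlam hβ M
  obtain ⟨C, hC, hgag⟩ := FracChoquard.exists_gagliardo_le hN1 hΩo hΩb hσ0 hσs hm1 hm2 hmr
    (A := ENNReal.ofReal A) ENNReal.ofReal_ne_top
  refine ⟨(C ^ (1 / m)).toReal, fun n hn => ?_⟩
  have hun := hu n hn
  have hur := (FracChoquard.lintegral_rpow_eq_one_of_eLpNorm hr0 (hu1 n hn)).le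
  have hpos := FracChoquard.ae_pos_of_locally_pos hN1 hΩo hΩb hun.locally_pos
  have hg := hgag (u n) hun.memH.memLp.1 hun.memH.zero_outside hur
    (hA n (μ n) (u n) hn (hμ n hn) (hM n hn) hun hpos hur)
  refine ⟨⟨?_, hg.trans_lt hC.lt_top, hun.memH.zero_outside⟩, ?_⟩
  · exact FracChoquard.memLp_of_memLp_two_of_zero_outside hΩb hΩo hm2.le hun.memH.memLp
      hun.memH.zero_outside
  · have hm0 : 0 ≤ 1 / m := by positivity
    rw [ENNReal.ofReal_toReal (ENNReal.rpow_ne_top_of_nonneg hm0 hC)]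
    exact ENNReal.rpow_le_rpow hg hm0
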